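/- Setting. Let $X$ be a 3-Sasakian 7-manifold with its locally free right $SU(2)$-action, $\pi:X\to Z=X/SU(2)$ the (orbi-)bundle over the anti-self-dual Einstein 4-(orbi)fold $(Z,g_Z)$ of scalar curvature $s>0$, and $\eta=\sum_i\eta_i\otimes T_i$ the $\mathfrak{su}(2)$-valued Levi-Civita connection form on $X$, where $[T_i,T_j]=2\varepsilon_{ijk}T_k$ and $F_\eta=-\frac{s}{24}\sum_i\omega_i\otimes T_i$ with $\omega_1,\omega_2,\omega_3$ the standard orthogonal basis ($|\omega_i|=\sqrt2$) of the self-dual 2-forms of $\pi^*g_Z$. Let $E=X\times_{SU(2)}\mathbb C^2\to Z$, with zero section $Z\subset E$ and polar decomposition $E\setminus Z\cong(0,\infty)_r\times X$. Given $\nu_0>0$, let $t(r),\nu(r)$, $r\ge0$, solve $t'=1-2t^2/\nu^2$, $(\nu^2)'=6t$, $t(0)=0$, $\nu(0)=\nu_0$, $\nu>0$, and equip $E$ with the $Spin(7)$-holonomy structure which on $E\setminus Z$ is $\Theta=dr\wedge\varphi+\psi$, where $$\varphi=t^3\eta_1\wedge\eta_2\wedge\eta_3-\tfrac{s}{48}t\nu^2\sum_i\eta_i\wedge\omega_i,\qquad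 \psi=\tfrac{\nu^4}{6}\left(\tfrac{s}{48}\right)^2\sum_i\omega_i\wedge\omega_i-\tfrac{s}{48}\nu^2t^2(\eta_1\wedge\eta_2\wedge\omega_3+\eta_2\wedge\eta_3\wedge\omega_1+\eta_3\wedge\eta_1\wedge\omega_2),$$ with metric $g_\Theta=dr^2+t^2\sum_i\eta_i^2+\frac{s}{48}\nu^2\pi^*g_Z$. A connection $A$ on $E\setminus Z$ is a $Spin(7)$-instanton if $*(F_A\wedge\Theta)=-F_A$. For $y_0>0$ let $A_{y_0}$ be the smooth connection on the trivial $SU(2)$-bundle over $E$ which on $E\setminus Z$ is a $Spin(7)$-instanton of the form $x(r)\sum_i\eta_i\otimes T_i$ with $x(r)=r^2y(r)$ and $y(0)=y_0$. Let $A_{\lim}$ be the $Spin(7)$-instanton on $E\setminus Z$ of the form $x(r)\sum_i\eta_i\otimes T_i$ with $x(r)\to1$ as $r\to0$ (its limit along $Z$ is the Levi-Civita connection $\eta$). For $z\in Z$ and $\lambda>0$ let $s_{z,\lambda}(v)=\exp_z(\lambda v)$, $v\in N_zZ$, where $\exp$ is the exponential map of $g_\Theta$ and $N_zZ\cong\mathbb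 R^4$ is the normal space of $Z$ in $E$ at $z$ (in the orbifold case: in a local uniformizing chart). For $\kappa>0$ let $$A_\kappa^{\mathrm{asd}}=\frac{\kappa|v|^2}{1+\kappa|v|^2}\sum_i\eta_i\otimes T_i$$ be the charge-1 ASD instanton on $\mathbb R^4$, where here the $\eta_i$ are the standard left-invariant coframing of $SU(2)=S^3$, pulled back to $\mathbb R^4\setminus0$. Theorem. (a) For every $\kappa>0$ put $\lambda(y_0)=\sqrt{\kappa/y_0}$. Then $\lambda(y_0)\to0$ as $y_0\to\infty$. Moreover $(s_{z,\lambda(y_0)})^*A_{y_0}\to A_\kappa^{\mathrm{asd}}$ as $y_0\to\infty$ in $C^k$ on the unit ball $B_1\subset N_zZ\cong\mathbb R^4$ for every $k$, uniformly in $z\in Z$. Under the identification $\mathbb R^4=\mathbb C^2\cong E_z\cong N_zZ$ given by a point of $X$ over $z$, the map $s_{z,\lambda}$ is $v\mapsto\lambda v\in E_z$. (b) As $y_0\to\infty$, $A_{y_0}\to A_{\lim}$ uniformly with all derivatives on compact subsets of $E\setminus Z$. -/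

import Mathlib

open Set Filter Topology MeasureTheory
open scoped Manifold ContDiff Quaternion

noncomputable section

namespace SpinSeven

/-! ### Differential one-forms on manifolds -/

section Forms

variable {E : Type*} [NormedAddCommGroup E] [NormedSpace ℝ E]
  {H : Type*} [TopologicalSpace H]
  {E' : Type*} [NormedAddCommGroup E'] [NormedSpace ℝ E']
  {H' : Type*} [TopologicalSpace H']

/-- One-forms on a manifold `M` with values in a normed space `F` (no regularity). -/
abbrev OneForm (I : ModelWithCorners ℝ E H) (M : Type*) [TopologicalSpace M] [ChartedSpace H M]
    (F : Type*) [NormedAddCommGroup F] [NormedSpace ℝ F] : Type _ :=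
  ∀ m : M, TangentSpace I m →L[ℝ] F

variable (I : ModelWithCorners ℝ E H) (I' : ModelWithCorners ℝ E' H')
  {M : Type*} [TopologicalSpace M] [ChartedSpace H M]
  {M' : Type*} [TopologicalSpace M'] [ChartedSpace H' M']
  {F : Type*} [NormedAddCommGroup F] [NormedSpace ℝ F]

/-- The coefficient function of a one-form in the chart around `m₀`: its pull-back under the
inverse of the chart. It is meaningful on the target of the chart. -/
def OneForm.inChart (α : OneForm I M F) (m₀ : M) : E → E →L[ℝ] F := fun y =>
  (α ((extChartAt I m₀).symm y)).comp (mfderiv 𝓘(ℝ, E) I (extChartAt I m₀).symm y)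

/-- A one-form is smooth if its coefficient functions in the charts are. -/
def OneForm.IsSmooth (α : OneForm I M F) : Prop :=
  ∀ m₀ : M, ContDiffOn ℝ ∞ (OneForm.inChart I α m₀) (extChartAt I m₀).target

/-- The pull-back of a one-form on `M` under a map `f : M' → M`. -/
def OneForm.pullback (f : M' → M) (α : OneForm I M F) : OneForm I' M' F := fun m =>
  (α (f m)).comp (mfderiv I' I f m)

/-- The exterior derivative of a one-form, `(dα)(u, v) = (∂_u α)(v) - (∂_v α)(u)`, computed in the
chart around the base point (the chart through which Mathlib identifies the tangent space with the
model space). -/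
def OneForm.extD (α : OneForm I M F) (m : M) (u v : TangentSpace I m) : F :=
  (fderiv ℝ (OneForm.inChart I α m) (extChartAt I m m) (u : E)) (v : E)
    - (fderiv ℝ (OneForm.inChart I α m) (extChartAt I m m) (v : E)) (u : E)

/-- The curvature `dα + ½ [α ∧ α]` of a quaternion-valued (in practice: imaginary
quaternion-valued) one-form; `½ [α ∧ α](u, v) = [α u, α v]`. -/
def OneForm.curvature (α : OneForm I M ℍ[ℝ]) (m : M) (u v : TangentSpace I m) : ℍ[ℝ] :=
  OneForm.extD I α m u v + (α m u * α m v - α m v * α m u)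

/-- A one-form on a vector space `E`, as a function `E → E →L[ℝ] F`. -/
def OneForm.coeff (α : OneForm 𝓘(ℝ, E) E F) : E → E →L[ℝ] F := fun y => α y

/-- `C^∞`-convergence on compact subsets of `U ⊆ M`, as `y₀ → ∞`, of a family of one-forms: in every
chart all derivatives of the coefficient functions converge uniformly on compact sets. -/
def OneForm.TendstoSmoothlyOnCompacts (U : Set M) (A : ℝ → OneForm I M F) (B : OneForm I M F) :
    Prop :=
  ∀ (m₀ : M) (K : Set E), IsCompact K → K ⊆ (extChartAt I m₀).target →
    (extChartAt I m₀).symm '' K ⊆ U → ∀ k : ℕ,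
      TendstoUniformlyOn (fun (y₀ : ℝ) y => iteratedFDeriv ℝ k (OneForm.inChart I (A y₀) m₀) y)
        (iteratedFDeriv ℝ k (OneForm.inChart I B m₀)) atTop K

/-- Smoothness of a field of bilinear forms on a (finite-dimensional) manifold: its coefficient
functions in the charts are smooth. -/
def IsSmoothBilin (h : ∀ m : M, TangentSpace I m →L[ℝ] TangentSpace I m →L[ℝ] ℝ) : Prop :=
  ∀ (m₀ : M) (u v : E), ContDiffOn ℝ ∞
    (fun y : E => h ((extChartAt I m₀).symm y)
      (mfderiv 𝓘(ℝ, E) I (extChartAt I m₀).symm y u)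
      (mfderiv 𝓘(ℝ, E) I (extChartAt I m₀).symm y v))
    (extChartAt I m₀).target

end Forms

/-! ### Wedge products of alternating forms on a vector space, as functions of vectors -/

section Wedge

variable {V : Type*}

/-- `α ∧ β` for one-forms. -/
def wedge11 (α β : V → ℝ) (a b : V) : ℝ := α a * β b - α b * β a

/-- `α ∧ β` for a one-form and a two-form. -/
def wedge12 (α : V → ℝ) (β : V → V → ℝ) (a b c : V) : ℝ :=
  α a * β b c - α b * β a c + α c * β a b

/-- `α ∧ φ` for a one-form and a three-form. -/
def wedge13 (α : V → ℝ) (φ : V → V → V → ℝ) (a b c d : V) : ℝ :=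
  α a * φ b c d - α b * φ a c d + α c * φ a b d - α d * φ a b c

/-- `β ∧ σ` for two-forms. -/
def wedge22 (β σ : V → V → ℝ) (a b c d : V) : ℝ :=
  β a b * σ c d - β a c * σ b d + β a d * σ b c
    + β b c * σ a d - β b d * σ a c + β c d * σ a b

end Wedge

/-! ### The principal bundle `X → Z` -/

/-- The group `SU(2)`, as the unit quaternions. Its Lie algebra consists of the imaginary
quaternions, with `T₁ = i`, `T₂ = j`, `T₃ = k`, so that `[T_i, T_j] = 2 ε_{ijk} T_k`. The standard
representation on `ℂ² = ℍ` is left multiplication. -/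
abbrev SU2 : Type := Metric.sphere (0 : ℍ[ℝ]) 1

instance factFinrankQuaternion : Fact (Module.finrank ℝ ℍ[ℝ] = 3 + 1) :=
  ⟨by rw [Quaternion.finrank_eq_four]⟩

/-- The components of a quaternion along `T₁, T₂, T₃`. -/
def imComp (i : Fin 3) (q : ℍ[ℝ]) : ℝ := ![q.imI, q.imJ, q.imK] i

/-- A 3-Sasakian `SU(2)`-structure on the 7-manifold `X`, described through the (orbi-)bundle
`π : X → Z = X / SU(2)`: a smooth right action of `SU(2)`, a connection form
`η = ∑ η_i T_i` with values in `su(2)`, and the pull-back `h = π^* g_Z` of a metric on `Z`, such that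
the curvature of `η` is `F_η = -(s/24) ∑ ω_i T_i`, where `ω₁, ω₂, ω₃` is the standard orthogonal
basis (`|ω_i| = √2`) of the self-dual two-forms of `h`, for a suitable oriented
orthonormal frame of `ker η` at each point. This says that `g_Z` is an anti-self-dual Einstein
metric of scalar curvature `s > 0`, and that `η` is the Levi-Civita connection on the bundle `X`
lifting the frame bundle of the self-dual two-forms of `Z`; the metric `∑ η_i² + (s/48) h` is the
3-Sasakian one. The action is locally free by `eta_orbit`; it is not assumed to be free, so
that `Z` may be an orbifold. -/
structure ThreeSasakian (X : Type*) [TopologicalSpace X]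
    [ChartedSpace (EuclideanSpace ℝ (Fin 7)) X] where
  /-- the right action of `SU(2)` -/
  act : X → SU2 → X
  act_one : ∀ p, act p 1 = p
  act_mul : ∀ p g g', act (act p g) g' = act p (g * g')
  act_smooth : ContMDiff ((𝓡 7).prod (𝓡 3)) (𝓡 7) ∞ (fun q : X × SU2 => act q.1 q.2)
  /-- the connection form -/
  η : OneForm (𝓡 7) X ℍ[ℝ]
  eta_smooth : OneForm.IsSmooth (𝓡 7) η
  eta_im : ∀ p (U : TangentSpace (𝓡 7) p), (η p U).re = 0
  /-- On each orbit, `η` is the Maurer-Cartan form `g⁻¹ dg`. -/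
  eta_orbit : ∀ p (g : SU2) (ξ : TangentSpace (𝓡 3) g),
    η (act p g) (mfderiv (𝓡 3) (𝓡 7) (act p) g ξ) =
      star (g : ℍ[ℝ]) * mvfderiv (𝓡 3) (fun g : SU2 => (g : ℍ[ℝ])) g ξ
  /-- `R_g^* η = Ad(g⁻¹) η`. -/
  eta_equivariant : ∀ (g : SU2) p (U : TangentSpace (𝓡 7) p),
    η (act p g) (mfderiv (𝓡 7) (𝓡 7) (fun p => act p g) p U) = star (g : ℍ[ℝ]) * η p U * g
  /-- the horizontal metric `π^* g_Z` -/
  h : ∀ p : X, TangentSpace (𝓡 7) p →L[ℝ] TangentSpace (𝓡 7) p →L[ℝ] ℝ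
  h_smooth : IsSmoothBilin (𝓡 7) h
  h_symm : ∀ p U V, h p U V = h p V U
  h_orbit : ∀ p (g : SU2) (ξ : TangentSpace (𝓡 3) g) V,
    h (act p g) (mfderiv (𝓡 3) (𝓡 7) (act p) g ξ) V = 0
  h_invariant : ∀ (g : SU2) p (U V : TangentSpace (𝓡 7) p),
    h (act p g) (mfderiv (𝓡 7) (𝓡 7) (fun p => act p g) p U)
      (mfderiv (𝓡 7) (𝓡 7) (fun p => act p g) p V) = h p U V
  /-- the scalar curvature of `g_Z` -/
  s : ℝ
  s_pos : 0 < s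
  curvature_eq : ∀ p : X, ∃ e : Fin 4 → TangentSpace (𝓡 7) p,
    (∀ a, η p (e a) = 0) ∧ (∀ a b, h p (e a) (e b) = if a = b then 1 else 0) ∧
    ∀ U V : TangentSpace (𝓡 7) p, OneForm.curvature (𝓡 7) η p U V =
      (-(s / 24)) • (⟨0,
        wedge11 (fun W => h p (e 0) W) (fun W => h p (e 1) W) U V
          + wedge11 (fun W => h p (e 2) W) (fun W => h p (e 3) W) U V,
        wedge11 (fun W => h p (e 0) W) (fun W => h p (e 2) W) U V
          + wedge11 (fun W => h p (e 3) W) (fun W => h p (e 1) W) U V,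
        wedge11 (fun W => h p (e 0) W) (fun W => h p (e 3) W) U V
          + wedge11 (fun W => h p (e 1) W) (fun W => h p (e 2) W) U V⟩ : ℍ[ℝ])

/-- The model with corners of `X × ℍ`. -/
abbrev IP := (𝓡 7).prod 𝓘(ℝ, ℍ[ℝ])

/-- The model with corners of `X × ℝ`, which contains `X × (0, ∞) ≅ E ∖ Z`. -/
abbrev IC := (𝓡 7).prod 𝓘(ℝ, ℝ)

/-- The functions `t` and `ν` of `r ≥ 0` for which `Θ` is closed and extends over the zero
section: `t' = 1 - 2 t² / ν²`, `(ν²)' = 6 t`, `t(0) = 0`, `ν(0) = ν₀ > 0`. -/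
structure IsProfile (ν₀ : ℝ) (t ν : ℝ → ℝ) : Prop where
  nu_zero_pos : 0 < ν₀
  t_zero : t 0 = 0
  nu_zero : ν 0 = ν₀
  nu_pos : ∀ r, 0 ≤ r → 0 < ν r
  deriv_t : ∀ r, 0 ≤ r → HasDerivWithinAt t (1 - 2 * t r ^ 2 / ν r ^ 2) (Ici 0) r
  deriv_nu : ∀ r, 0 ≤ r → HasDerivWithinAt (fun r => ν r ^ 2) (6 * t r) (Ici 0) r

namespace ThreeSasakian

variable {X : Type*} [TopologicalSpace X] [ChartedSpace (EuclideanSpace ℝ (Fin 7)) X]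
  (S : ThreeSasakian X)

/-! ### The bundle `E = X ×_{SU(2)} ℍ` and the polar decomposition of `E ∖ Z` -/

/-- The `SU(2)`-orbits on `X × ℍ` for `(p, v) · g = (p g, g⁻¹ v)`. -/
def orbitRel (a b : X × ℍ[ℝ]) : Prop :=
  ∃ g : SU2, b = (S.act a.1 g, star (g : ℍ[ℝ]) * a.2)

/-- The total space of `E = X ×_{SU(2)} ℍ → Z`, of which `X × ℍ` is a (principal `SU(2)`-) cover.
Smooth curves in `E`, smooth maps to `E` and tensor fields on `E` are handled through their lifts to
`X × ℍ`. The zero section `Z ⊆ E` consists of the classes of the `(p, 0)`. -/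
def TotalSpaceE : Type _ := Quot S.orbitRel

/-- The projection `X × ℍ → E`. -/
def proj (a : X × ℍ[ℝ]) : S.TotalSpaceE := Quot.mk _ a

/-- The unit quaternion `v / |v|` (and `1` for `v = 0`). -/
def unitPart (v : ℍ[ℝ]) : SU2 :=
  open Classical in
  if hv : v = 0 then 1
  else ⟨‖v‖⁻¹ • v, by
    rw [mem_sphere_zero_iff_norm, norm_smul, norm_inv, norm_norm,
      inv_mul_cancel₀ (norm_ne_zero_iff.mpr hv)]⟩

/-- The polar decomposition: the lift to `X × (ℍ ∖ 0)` of the diffeomorphism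
`E ∖ Z ≅ X × (0, ∞)`. -/
def polar (a : X × ℍ[ℝ]) : X × ℝ := (S.act a.1 (unitPart a.2), ‖a.2‖)

/-! ### The `Spin(7)`-structure -/

/-- The two-forms `ω_i` on `X`, defined by `F_η = -(s/24) ∑ ω_i T_i`. -/
def omega (i : Fin 3) (p : X) (U V : TangentSpace (𝓡 7) p) : ℝ :=
  -(24 / S.s) * imComp i (OneForm.curvature (𝓡 7) S.η p U V)

/-- The differential of `X × ℝ → X`. -/
def dX (q : X × ℝ) : TangentSpace IC q →L[ℝ] TangentSpace (𝓡 7) q.1 :=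
  mfderiv IC (𝓡 7) (Prod.fst : X × ℝ → X) q

/-- The one-form `dr` on `X × ℝ`. -/
def dr (q : X × ℝ) : TangentSpace (IC : ModelWithCorners ℝ _ _) q →L[ℝ] ℝ :=
  mvfderiv IC (Prod.snd : X × ℝ → ℝ) q

/-- `η_i`, pulled back to `X × ℝ`. -/
def ηR (i : Fin 3) (q : X × ℝ) (a : TangentSpace IC q) : ℝ := imComp i (S.η q.1 (dX q a))

/-- `ω_i`, pulled back to `X × ℝ`. -/
def ωR (i : Fin 3) (q : X × ℝ) (a b : TangentSpace IC q) : ℝ := S.omega i q.1 (dX q a) (dX q b)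

/-- The metric `g_Θ = dr² + t² ∑ η_i² + (s/48) ν² π^* g_Z` on `X × (0, ∞)`. -/
def gΘ (t ν : ℝ → ℝ) (q : X × ℝ) (a b : TangentSpace IC q) : ℝ :=
  dr q a * dr q b + t q.2 ^ 2 * ∑ i, S.ηR i q a * S.ηR i q b
    + S.s / 48 * ν q.2 ^ 2 * S.h q.1 (dX q a) (dX q b)

/-- The three-form
`φ = t³ η₁ ∧ η₂ ∧ η₃ - (s/48) t ν² (η₁ ∧ ω₁ + η₂ ∧ ω₂ + η₃ ∧ ω₃)`. -/
def φ (t ν : ℝ → ℝ) (q : X × ℝ) (a b c : TangentSpace IC q) : ℝ :=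
  t q.2 ^ 3 * wedge12 (S.ηR 0 q) (wedge11 (S.ηR 1 q) (S.ηR 2 q)) a b c
    - S.s / 48 * t q.2 * ν q.2 ^ 2 * ∑ i, wedge12 (S.ηR i q) (S.ωR i q) a b c

/-- The four-form
`ψ = (ν⁴/6) (s/48)² ∑ ω_i ∧ ω_i - (s/48) ν² t² (η₁ ∧ η₂ ∧ ω₃ + η₂ ∧ η₃ ∧ ω₁ + η₃ ∧ η₁ ∧ ω₂)`. -/
def ψ (t ν : ℝ → ℝ) (q : X × ℝ) (a b c d : TangentSpace IC q) : ℝ :=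
  ν q.2 ^ 4 / 6 * (S.s / 48) ^ 2 * ∑ i, wedge22 (S.ωR i q) (S.ωR i q) a b c d
    - S.s / 48 * ν q.2 ^ 2 * t q.2 ^ 2 *
      ∑ i, wedge22 (wedge11 (S.ηR (i + 1) q) (S.ηR (i + 2) q)) (S.ωR i q) a b c d

/-- The Cayley form `Θ = dr ∧ φ + ψ` on `X × (0, ∞)`. -/
def Θ (t ν : ℝ → ℝ) (q : X × ℝ) (a b c d : TangentSpace IC q) : ℝ :=
  wedge13 (fun w => dr q w) (S.φ t ν q) a b c d + S.ψ t ν q a b c d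

/-! ### `Spin(7)`-instantons in radial form -/

/-- The connection `x(r) ∑ η_i ⊗ T_i` on the trivial bundle over `X × (0, ∞) ≅ E ∖ Z`. -/
def radialForm (x : ℝ → ℝ) : OneForm IC (X × ℝ) ℍ[ℝ] := fun q =>
  x q.2 • (S.η q.1).comp (dX q)

/-- `A` is a `Spin(7)`-instanton on `X × (0, ∞)`: its curvature lies in `Λ²₂₁ ⊗ su(2)`, that is
`*(F_A ∧ Θ) = -F_A`. As `Θ` is self-dual, `*(F ∧ Θ)` is the contraction
`(u, v) ↦ ½ ∑_{a, b} Θ(u, v, e_a, e_b) F(e_a, e_b)` of `Θ` with `F`, for any `g_Θ`-orthonormal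
frame `e`. -/
def IsSpinSevenInstanton (t ν : ℝ → ℝ) (A : OneForm IC (X × ℝ) ℍ[ℝ]) : Prop :=
  ∀ q : X × ℝ, 0 < q.2 → ∀ e : Fin 8 → TangentSpace IC q,
    (∀ a b, S.gΘ t ν q (e a) (e b) = if a = b then 1 else 0) →
    ∀ u v : TangentSpace IC q,
      (1 / 2 : ℝ) • ∑ a, ∑ b, S.Θ t ν q u v (e a) (e b) • OneForm.curvature IC A q (e a) (e b)
        = -OneForm.curvature IC A q u v

/-- `x` is the radial function of a smooth `Spin(7)`-instanton `x(r) ∑ η_i ⊗ T_i` on `E ∖ Z`. -/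
structure IsRadialInstanton (t ν x : ℝ → ℝ) : Prop where
  smooth : ContDiffOn ℝ ∞ x (Ioi 0)
  instanton : S.IsSpinSevenInstanton t ν (S.radialForm x)

/-- `A` is the instanton `A_{y₀}` on the trivial bundle over `E`. It is a smooth connection form on
`E`, given by its pull-back to `X × ℍ` (which is basic, since `polar` is constant on orbits); on `E ∖ Z` it is a `Spin(7)`-instanton of the form
`x(r) ∑ η_i ⊗ T_i`; and `x(r) = r² y(r)` with `y(0) = y₀`. -/
structure IsInstantonWithParameter (t ν : ℝ → ℝ) (y₀ : ℝ) (A : OneForm IP (X × ℍ[ℝ]) ℍ[ℝ]) :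
    Prop where
  smooth : OneForm.IsSmooth IP A
  radial : ∃ x : ℝ → ℝ, S.IsRadialInstanton t ν x ∧
    (∀ a : X × ℍ[ℝ], a.2 ≠ 0 → A a = OneForm.pullback IC IP S.polar (S.radialForm x) a) ∧
    Tendsto (fun r => x r / r ^ 2) (𝓝[>] 0) (𝓝 y₀)

/-- `A` is (on `E ∖ Z`) the instanton `A_lim`: a `Spin(7)`-instanton of the form
`x(r) ∑ η_i ⊗ T_i` whose limit `lim_{r → 0} x(r) ∑ η_i ⊗ T_i` along `Z` is the Levi-Civita
connection `η`. -/
def IsLimitInstanton (t ν : ℝ → ℝ) (A : OneForm IC (X × ℝ) ℍ[ℝ]) : Prop :=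
  ∃ x : ℝ → ℝ, S.IsRadialInstanton t ν x ∧ Tendsto x (𝓝[>] 0) (𝓝 1) ∧
    ∀ q : X × ℝ, 0 < q.2 → A q = S.radialForm x q

/-! ### The metric on `E`, geodesics and the normal exponential map -/

/-- The metric `g_Θ` on `E`, pulled back to `X × ℍ`. Off the zero section it is the metric on
`X × (0, ∞)`; over the zero section it is its continuous extension, the sum of `(s/48) ν(0)² π^* g_Z`
and of the flat metric of the fibre. -/
def gE (t ν : ℝ → ℝ) (a : X × ℍ[ℝ]) (α β : TangentSpace IP a) : ℝ :=
  open Classical in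
  if a.2 = 0 then
    inner ℝ (mvfderiv IP (Prod.snd : X × ℍ[ℝ] → ℍ[ℝ]) a α)
        (mvfderiv IP (Prod.snd : X × ℍ[ℝ] → ℍ[ℝ]) a β)
      + S.s / 48 * ν 0 ^ 2 * S.h a.1 (mfderiv IP (𝓡 7) (Prod.fst : X × ℍ[ℝ] → X) a α)
        (mfderiv IP (𝓡 7) (Prod.fst : X × ℍ[ℝ] → X) a β)
  else S.gΘ t ν (S.polar a) (mfderiv IP IC S.polar a α) (mfderiv IP IC S.polar a β)

/-- The velocity of a curve in `X × ℍ`. -/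
def velocity (c : ℝ → X × ℍ[ℝ]) (τ : ℝ) : TangentSpace IP (c τ) :=
  mfderiv 𝓘(ℝ, ℝ) IP c τ (1 : ℝ)

/-- The `g_Θ`-length of (the image in `E` of) a curve on `[0, 1]`. -/
def curveLength (t ν : ℝ → ℝ) (c : ℝ → X × ℍ[ℝ]) : ENNReal :=
  ∫⁻ τ in Icc (0 : ℝ) 1, ENNReal.ofReal √(S.gE t ν (c τ) (velocity c τ) (velocity c τ))

/-- The image in `E` of the smooth curve `c` is a geodesic of `g_Θ` on `[0, 1]`: it has constant
speed and locally minimizes length among the curves in `E` with the same end points. -/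
structure IsGeodesicLift (t ν : ℝ → ℝ) (c : ℝ → X × ℍ[ℝ]) : Prop where
  smooth : ContMDiff 𝓘(ℝ, ℝ) IP ∞ c
  minimizing : ∃ speed : ℝ, 0 ≤ speed ∧
    (∀ τ ∈ Icc (0 : ℝ) 1, S.gE t ν (c τ) (velocity c τ) (velocity c τ) = speed ^ 2) ∧
    ∀ τ₀ ∈ Icc (0 : ℝ) 1, ∃ ε > 0, ∀ τ₁ ∈ Icc (0 : ℝ) 1, ∀ τ₂ ∈ Icc (0 : ℝ) 1,
      |τ₁ - τ₀| < ε → |τ₂ - τ₀| < ε → τ₁ ≤ τ₂ →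
      ∀ γ : ℝ → X × ℍ[ℝ], ContMDiff 𝓘(ℝ, ℝ) IP 1 γ →
        S.proj (γ 0) = S.proj (c τ₁) → S.proj (γ 1) = S.proj (c τ₂) →
        ENNReal.ofReal ((τ₂ - τ₁) * speed) ≤ S.curveLength t ν γ

/-- The normal vector at the point `z = [(p, 0)]` of the zero section which corresponds to `v ∈ ℍ`
under the identification `ℍ ≅ N_z Z` defined by `p`: the velocity of `τ ↦ [(p, τ v)]` at `0`. -/
def normalVector (p : X) (v : ℍ[ℝ]) : TangentSpace IP ((p, 0) : X × ℍ[ℝ]) :=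
  mfderiv 𝓘(ℝ, ℍ[ℝ]) IP (fun w : ℍ[ℝ] => ((p, w) : X × ℍ[ℝ])) 0 v

/-- A vector tangent to the zero section at `[(p, 0)]`. -/
def zeroSectionVector (p : X) (U : TangentSpace (𝓡 7) p) : TangentSpace IP ((p, 0) : X × ℍ[ℝ]) :=
  mfderiv (𝓡 7) IP (fun p' : X => ((p', 0) : X × ℍ[ℝ])) p U

/-- `ℍ → N_z Z` is an isometry onto its image. -/
theorem gE_normalVector (t ν : ℝ → ℝ) (p : X) (v w : ℍ[ℝ]) :
    S.gE t ν (p, 0) (normalVector p v) (normalVector p w) = inner ℝ v w := by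
  simp only [gE, if_true, normalVector, mvfderiv, mfderiv_prod_right, mfderiv_snd, mfderiv_fst]
  change inner ℝ v w + S.s / 48 * ν 0 ^ 2 * S.h p (0 : TangentSpace (𝓡 7) p) 0 = inner ℝ v w
  simp

/-- The vectors `normalVector p v` are orthogonal to the zero section. -/
theorem gE_normalVector_zeroSectionVector (t ν : ℝ → ℝ) (p : X) (v : ℍ[ℝ])
    (U : TangentSpace (𝓡 7) p) :
    S.gE t ν (p, 0) (normalVector p v) (zeroSectionVector p U) = 0 := by
  simp only [gE, if_true, normalVector, zeroSectionVector, mvfderiv, mfderiv_prod_right,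
    mfderiv_prod_left, mfderiv_snd, mfderiv_fst]
  change inner ℝ v (0 : ℍ[ℝ]) + S.s / 48 * ν 0 ^ 2 * S.h p (0 : TangentSpace (𝓡 7) p) U = 0
  simp

/-- The map `f : ℍ → X × ℍ` is a lift of the scaled exponential map
`s_{z, lam} : v ↦ exp_z (lam v)` on `N_z Z ≅ ℍ`, `z = [(p, 0)]`: each `f v` is
the value at time `1` of a `g_Θ`-geodesic which starts at `z` with velocity `lam v`. (The two sides of
the equation of velocities are tangent vectors at the same point `c 0 = (p, 0)`.) -/
def IsScaledExp (t ν : ℝ → ℝ) (p : X) (lam : ℝ) (f : ℍ[ℝ] → X × ℍ[ℝ]) : Prop :=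
  ∀ v : ℍ[ℝ], ∃ c : ℝ → X × ℍ[ℝ], S.IsGeodesicLift t ν c ∧ c 0 = (p, 0) ∧
    @Eq (EuclideanSpace ℝ (Fin 7) × ℍ[ℝ]) (velocity c 0) (normalVector p (lam • v)) ∧
    c 1 = f v

end ThreeSasakian

/-- The lift `X × (0, ∞) → X × ℍ`, `(p, r) ↦ (p, r · 1)`, of the inverse of the polar
decomposition. -/
def fromPolar {X : Type*} (q : X × ℝ) : X × ℍ[ℝ] := (q.1, (q.2 : ℍ[ℝ]))

/-- The map `v ↦ (p, lam v)`, which lifts `v ↦ [(p, lam v)]`. -/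
def fibreMap {X : Type*} (p : X) (lam : ℝ) (v : ℍ[ℝ]) : X × ℍ[ℝ] := (p, lam • v)

/-! ### The instanton on `ℝ⁴` -/

/-- The left-invariant `su(2)`-valued one-form `∑ η_i ⊗ T_i = g⁻¹ dg` of `S³ = SU(2)`, pulled back to
`ℍ ∖ 0` under `v ↦ v / |v|`: it is `|v|⁻² Im (v̄ dv)`. -/
def leftInvariantForm (v : ℍ[ℝ]) : ℍ[ℝ] →L[ℝ] ℍ[ℝ] :=
  LinearMap.toContinuousLinearMap
    { toFun := fun w => (‖v‖ ^ 2)⁻¹ • (star v * w).im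
      map_add' := fun w w' => by simp [mul_add]
      map_smul' := fun c w => by simp [smul_comm c] }

/-- The basic charge-one ASD instanton
`A_κ^asd = κ r² / (1 + κ r²) ∑ η_i ⊗ T_i` on `ℝ⁴ = ℍ`, `r = |v|`; it equals
`κ Im (v̄ dv) / (1 + κ |v|²)`. -/
def asdInstanton (κ : ℝ) : OneForm 𝓘(ℝ, ℍ[ℝ]) ℍ[ℝ] ℍ[ℝ] := fun v =>
  (κ * ‖v‖ ^ 2 / (1 + κ * ‖v‖ ^ 2)) • leftInvariantForm v

end SpinSeven

end

open SpinSeven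

/-!
For a connection `x(r) η` the `Spin(7)`-instanton equation, written out in a frame adapted to the
splitting of `T X` into the orbit directions and `ker η`, is the Bernoulli equation
`x' = 2 x (1 - x) / t - 4 x t / ν²` (`radial_equation`). It is linear in `1 / x`, and together with
the equations of the profile it says that `t² / x - (ν² - ν₀²) / 3` is constant
(`IsProfile.radial_solution`). Hence the instantons are given by
`x = t² / (C + (ν² - ν₀²) / 3)`, where the behaviour at `r = 0` gives `C = 1 / y₀` for `A_{y₀}` and
`C = 0` for `A_lim`.

Away from the zero section `ν > ν₀`, so that this formula is smooth in `(C, r)` near `C = 0`.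
In general, the derivatives of a jointly smooth function converge uniformly on compact sets as the
parameter converges (`tendstoUniformlyOn_iteratedFDeriv_slice`), and part (b) follows on letting
`C = 1 / y₀` tend to `0`.

For part (a), put `τ(v) = t(|v|) / |v|` and `q(v) = (ν(|v|)² - ν₀²) / (3 |v|²)`. These are smooth
functions on `ℍ`, also at the origin (`exists_smooth_quotients`), with value `1` there. On a fibre
`η` is the left-invariant form of `SU(2)`, so the rescaled connection is the member with
`c = √(κ / y₀)` of the family `κ τ(c v)² / (1 + κ |v|² q(c v)) · Im (v̄ dv)`, which is smooth in
`(c, v)`, is the basic instanton at `c = 0`, and does not depend on the fibre.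

The exponential map is the identity in the fibre coordinates because the metric dominates `dr²`:
a curve is at least as long as the increase of its radial coordinate
(`ofReal_norm_sub_norm_le_curveLength`), with equality for rays (`isGeodesicLift_fibreLine`). Here
the horizontal form `h` is positive semidefinite (`h_self_nonneg`), because the `h`-orthonormal
frame of `ker η` in the curvature equation and the orbit directions, on which `h` vanishes, span.
-/

namespace SpinSeven

/-! ### Smooth dependence on a parameter -/

section Parameter

variable {E : Type*} [NormedAddCommGroup E] [NormedSpace ℝ E]
  {F : Type*} [NormedAddCommGroup F] [NormedSpace ℝ F]

/-- The derivatives of a slice are the restrictions of the joint derivatives; in particular they are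
jointly continuous. -/
theorem iteratedFDeriv_slice {Φ : ℝ × E → F} {U : Set (ℝ × E)} (hU : IsOpen U)
    (hΦ : ContDiffOn ℝ ∞ Φ U) {c : ℝ} {y : E} (hy : (c, y) ∈ U) (k : ℕ) :
    iteratedFDeriv ℝ k (fun z => Φ (c, z)) y =
      (iteratedFDeriv ℝ k Φ (c, y)).compContinuousLinearMap
        fun _ => ContinuousLinearMap.inr ℝ ℝ E := by
  set Ψ : ℝ × E → F := fun w => Φ (w + (c, 0)) with hΨ
  set V : Set (ℝ × E) := {w | w + (c, 0) ∈ U}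
  have hV : IsOpen V := hU.preimage (by fun_prop)
  have hΨV : ContDiffOn ℝ ∞ Ψ V :=
    hΦ.comp (f := fun w : ℝ × E => w + (c, 0)) (by fun_prop) fun w hw => hw
  have hV' : IsOpen (ContinuousLinearMap.inr ℝ ℝ E ⁻¹' V) :=
    hV.preimage (ContinuousLinearMap.inr ℝ ℝ E).continuous
  have hyV : ContinuousLinearMap.inr ℝ ℝ E y ∈ V := by simpa [V] using hy
  have h1 := (ContinuousLinearMap.inr ℝ ℝ E).iteratedFDerivWithin_comp_right hΨV
    hV.uniqueDiffOn hV'.uniqueDiffOn hyV (i := k) (mod_cast le_top)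
  rw [iteratedFDerivWithin_of_isOpen k hV' hyV, iteratedFDerivWithin_of_isOpen k hV hyV,
    hΨ, iteratedFDeriv_comp_add_right] at h1
  simpa [Function.comp_def] using h1

/-- The derivatives in `y` of a function `Φ (c, y)` which is jointly smooth near `{c₀} × K` converge
uniformly on the compact set `K` as `c → c₀`. -/
theorem tendstoUniformlyOn_iteratedFDeriv_slice {Φ : ℝ × E → F} {U : Set (ℝ × E)} (hU : IsOpen U)
    (hΦ : ContDiffOn ℝ ∞ Φ U) {c₀ : ℝ} {K : Set E} (hK : IsCompact K)
    (hKU : ∀ y ∈ K, (c₀, y) ∈ U) (k : ℕ) :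
    TendstoUniformlyOn (fun c => iteratedFDeriv ℝ k fun z => Φ (c, z))
      (iteratedFDeriv ℝ k fun z => Φ (c₀, z)) (𝓝 c₀) K := by
  rw [← tendstoLocallyUniformlyOn_iff_tendstoUniformlyOn_of_compact hK,
    Metric.tendstoLocallyUniformlyOn_iff]
  intro ε hε y hy
  set G : ℝ × E → E [×k]→L[ℝ] F := fun q => (iteratedFDeriv ℝ k Φ q).compContinuousLinearMap
        fun _ => ContinuousLinearMap.inr ℝ ℝ E
  have hG : ContinuousAt G (c₀, y) := by
    have h0 : ContinuousAt (iteratedFDeriv ℝ k Φ) (c₀, y) := by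
      have h1 := (hΦ.continuousOn_iteratedFDerivWithin (m := k) (mod_cast le_top)
        hU.uniqueDiffOn).continuousAt (hU.mem_nhds (hKU y hy))
      refine h1.congr (eventually_of_mem (hU.mem_nhds (hKU y hy)) fun q hq => ?_)
      exact iteratedFDerivWithin_of_isOpen k hU hq
    exact (ContinuousMultilinearMap.compContinuousLinearMapL
      (fun _ : Fin k => ContinuousLinearMap.inr ℝ ℝ E)).continuous.continuousAt.comp h0
  have hev : ∀ᶠ q in 𝓝 (c₀, y), q ∈ U ∧ dist (G q) (G (c₀, y)) < ε / 2 :=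
    (hU.eventually_mem (hKU y hy)).and (Metric.tendsto_nhds.1 hG _ (half_pos hε))
  rw [nhds_prod_eq] at hev
  obtain ⟨P, hP, Q, hQ, hPQ⟩ := eventually_prod_iff.1 hev
  refine ⟨{z | Q z}, mem_nhdsWithin_of_mem_nhds hQ, ?_⟩
  filter_upwards [hP] with c hc z hz
  have ha := hPQ hc hz
  have hb := hPQ hP.self_of_nhds hz
  rw [iteratedFDeriv_slice hU hΦ ha.1, iteratedFDeriv_slice hU hΦ hb.1]
  calc dist (G (c₀, z)) (G (c, z)) ≤ dist (G (c₀, z)) (G (c₀, y)) + dist (G (c, z)) (G (c₀, y)) :=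
        dist_triangle_right _ _ _
    _ < ε / 2 + ε / 2 := add_lt_add hb.2 ha.2
    _ = ε := add_halves ε

end Parameter

/-! ### Averages over rays -/

section Average

theorem hasFDerivAt_integral_smul_comp_smul {E F : Type*} [NormedAddCommGroup E]
    [NormedSpace ℝ E] [NormedAddCommGroup F] [NormedSpace ℝ F] [ProperSpace E]
    {f : E → F} (hf : ContDiff ℝ 1 f) (k : ℕ) (v : E) :
    HasFDerivAt (fun v => ∫ s in (0 : ℝ)..1, s ^ k • f (s • v))
      (∫ s in (0 : ℝ)..1, s ^ (k + 1) • fderiv ℝ f (s • v)) v := by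
  have hf' : Continuous (fderiv ℝ f) := hf.continuous_fderiv one_ne_zero
  have hc := hf.continuous
  obtain ⟨C, hC⟩ := (isCompact_closedBall (0 : E) (‖v‖ + 1)).exists_bound_of_continuousOn
    hf'.continuousOn
  refine intervalIntegral.hasFDerivAt_integral_of_dominated_of_fderiv_le
    (F' := fun v s => s ^ (k + 1) • fderiv ℝ f (s • v)) (bound := fun _ => C)
    (Metric.ball_mem_nhds v one_pos) ?_ ?_ ?_ ?_ ?_ ?_
  · exact Eventually.of_forall fun w => Continuous.aestronglyMeasurable (by fun_prop)
  · exact Continuous.intervalIntegrable (by fun_prop) _ _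
  · exact Continuous.aestronglyMeasurable (by fun_prop)
  · refine Eventually.of_forall fun s hs w hw => ?_
    rw [uIoc_of_le zero_le_one] at hs
    have hs1 : s ^ (k + 1) ≤ 1 := pow_le_one₀ hs.1.le hs.2
    have hw' : ‖w‖ ≤ ‖v‖ + 1 := by
      have := norm_sub_norm_le w v
      rw [mem_ball_iff_norm] at hw
      linarith
    have hsw : s • w ∈ Metric.closedBall (0 : E) (‖v‖ + 1) := by
      rw [mem_closedBall_zero_iff, norm_smul, Real.norm_of_nonneg hs.1.le]
      exact (mul_le_of_le_one_left (norm_nonneg _) hs.2).trans hw'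
    rw [norm_smul, Real.norm_of_nonneg (pow_nonneg hs.1.le _)]
    exact (mul_le_of_le_one_left (norm_nonneg _) hs1).trans (hC _ hsw)
  · exact intervalIntegrable_const
  · refine Eventually.of_forall fun s _ w _ => ?_
    have h1 : HasFDerivAt f (fderiv ℝ f (s • w)) (s • w) :=
      (hf.differentiable one_ne_zero _).hasFDerivAt
    have h2 := (h1.comp w ((hasFDerivAt_id w).const_smul s)).const_smul (s ^ k)
    convert! h2 using 1
    ext u
    simp [pow_succ, mul_smul]

universe u

/-- The weighted average `v ↦ ∫₀¹ sᵏ f(s v) ds` of a `C^n` function is `C^n`. -/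
theorem contDiff_integral_smul_comp_smul (n : ℕ) : ∀ {E F : Type u} [NormedAddCommGroup E]
    [NormedSpace ℝ E] [NormedAddCommGroup F] [NormedSpace ℝ F] [ProperSpace E]
    {f : E → F} (_ : ContDiff ℝ n f) (k : ℕ),
    ContDiff ℝ n (fun v => ∫ s in (0 : ℝ)..1, s ^ k • f (s • v)) := by
  induction n with
  | zero =>
    intro E F _ _ _ _ _ f hf k
    have hc : Continuous f := hf.continuous
    rw [Nat.cast_zero, contDiff_zero]
    exact intervalIntegral.continuous_parametric_intervalIntegral_of_continuous' (by fun_prop) _ _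
  | succ n ih =>
    intro E F _ _ _ _ _ f hf k
    have hf1 : ContDiff ℝ 1 f := hf.of_le (by exact_mod_cast Nat.succ_le_succ (Nat.zero_le n))
    rw [Nat.cast_succ] at hf ⊢
    rw [contDiff_succ_iff_hasFDerivAt]
    exact ⟨_, ih (hf.fderiv_right le_rfl) (k + 1),
      fun v => hasFDerivAt_integral_smul_comp_smul hf1 k v⟩

end Average

/-! ### Radial functions -/

section Radial

theorem eq_mul_integral_of_hasDerivWithinAt {f f' : ℝ → ℝ}
    (hf : ∀ r, 0 ≤ r → HasDerivWithinAt f (f' r) (Ici 0) r) (hf' : ContinuousOn f' (Ici 0))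
    (h0 : f 0 = 0) {r : ℝ} (hr : 0 ≤ r) : f r = r * ∫ s in (0 : ℝ)..1, f' (s * r) := by
  have hmaps : ∀ s ∈ Icc (0 : ℝ) 1, s * r ∈ Ici (0 : ℝ) := fun s hs => mul_nonneg hs.1 hr
  have hcont : ContinuousOn f (Ici 0) := fun r hr => (hf r hr).continuousWithinAt
  have hmul : Continuous fun s : ℝ => s * r := by fun_prop
  have h := intervalIntegral.integral_eq_sub_of_hasDeriv_right_of_le (a := 0) (b := 1)
    (f := fun s => f (s * r)) (f' := fun s => r * f' (s * r)) zero_le_one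
    (hcont.comp hmul.continuousOn hmaps) ?_ ?_
  · rw [← intervalIntegral.integral_const_mul, h]
    simp [h0]
  · intro s hs
    have h1 := hf (s * r) (hmaps s ⟨hs.1.le, hs.2.le⟩)
    have h2 : HasDerivWithinAt (fun s : ℝ => s * r) r (Ioi s) s := by
      simpa using (hasDerivWithinAt_id s (Ioi s)).mul_const r
    have h3 := h1.scomp s h2 fun u hu => mul_nonneg (hs.1.le.trans (le_of_lt hu)) hr
    simpa [Function.comp_def] using h3
  · refine ContinuousOn.intervalIntegrable ?_
    rw [uIcc_of_le zero_le_one]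
    exact continuousOn_const.mul (hf'.comp hmul.continuousOn hmaps)

/-- A radial function `f(|v|)` is differentiable, also at the origin, if `f'(r)` is divisible by
`r`. -/
theorem hasFDerivAt_comp_norm {V : Type*} [NormedAddCommGroup V] [InnerProductSpace ℝ V]
    {f : ℝ → ℝ} {f' c : ℝ} {v : V} (hf : HasDerivWithinAt f f' (Ici 0) ‖v‖)
    (hc : f' = ‖v‖ * c) : HasFDerivAt (fun w => f ‖w‖) (c • innerSL ℝ v) v := by
  by_cases hv : v = 0
  · subst hv
    have h0 : f' = 0 := by simp [hc]
    have h1 : (fun r => f r - f 0) =o[𝓝[Ici 0] 0] fun r => r := by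
      rw [norm_zero, h0] at hf
      simpa using hf.isLittleO
    have h2 : Tendsto (fun w : V => ‖w‖) (𝓝 0) (𝓝[Ici 0] 0) :=
      tendsto_nhdsWithin_iff.2 ⟨tendsto_norm_zero, Eventually.of_forall fun w => norm_nonneg w⟩
    have h3 := h1.comp_tendsto h2
    rw [hasFDerivAt_iff_isLittleO_nhds_zero]
    simpa [Function.comp_def] using h3.of_norm_right
  · have hv' : ‖v‖ ≠ 0 := norm_ne_zero_iff.2 hv
    have h1 : HasDerivAt f f' ‖v‖ := hf.hasDerivAt (Ici_mem_nhds (norm_pos_iff.2 hv))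
    have h2 : HasFDerivAt (fun w : V => √(‖w‖ ^ 2))
        ((1 / (2 * √(‖v‖ ^ 2))) • ((2 : ℕ) • innerSL ℝ v)) v :=
      (hasStrictFDerivAt_norm_sq v).hasFDerivAt.sqrt (by positivity)
    simp only [Real.sqrt_sq (norm_nonneg _)] at h2
    have h3 := h1.hasFDerivAt.comp v h2
    convert! h3 using 1
    ext w
    simp [hc]
    field_simp

end Radial

/-! ### The profile of the `Spin(7)`-metric -/

namespace IsProfile

variable {ν₀ : ℝ} {t ν : ℝ → ℝ} (h : IsProfile ν₀ t ν)
include h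

theorem continuousOn_t : ContinuousOn t (Ici 0) :=
  fun r hr => (h.deriv_t r hr).continuousWithinAt

theorem continuousOn_nu_sq : ContinuousOn (fun r => ν r ^ 2) (Ici 0) :=
  fun r hr => (h.deriv_nu r hr).continuousWithinAt

theorem nu_sq_ne_zero {r : ℝ} (hr : 0 ≤ r) : ν r ^ 2 ≠ 0 := (pow_pos (h.nu_pos r hr) 2).ne'

theorem hasDerivAt_t {r : ℝ} (hr : 0 < r) : HasDerivAt t (1 - 2 * t r ^ 2 / ν r ^ 2) r :=
  (h.deriv_t r hr.le).hasDerivAt (Ici_mem_nhds hr)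

theorem hasDerivAt_nu_sq {r : ℝ} (hr : 0 < r) : HasDerivAt (fun r => ν r ^ 2) (6 * t r) r :=
  (h.deriv_nu r hr.le).hasDerivAt (Ici_mem_nhds hr)

/-- The function `t³ ν²` is nondecreasing, because its derivative is `3 t² ν²`. -/
theorem t_nonneg {r : ℝ} (hr : 0 ≤ r) : 0 ≤ t r := by
  have hmono : MonotoneOn (fun r => t r ^ 3 * ν r ^ 2) (Ici 0) := by
    refine monotoneOn_of_hasDerivWithinAt_nonneg (f' := fun r => 3 * t r ^ 2 * ν r ^ 2)
      (convex_Ici 0) ((h.continuousOn_t.pow 3).mul h.continuousOn_nu_sq) ?_ ?_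
    · intro r hr
      rw [interior_Ici, mem_Ioi] at hr
      have h1 := ((h.hasDerivAt_t hr).pow 3).mul (h.hasDerivAt_nu_sq hr)
      have h2 := (h.nu_pos r hr.le).ne'
      refine (h1.congr_deriv ?_).hasDerivWithinAt
      simp only [Pi.pow_apply]
      field_simp
      push_cast
      ring
    · intro r _
      positivity
  have h1 := hmono (mem_Ici.2 le_rfl) hr hr
  simp only [h.t_zero] at h1
  have h2 : 0 < ν r ^ 2 := pow_pos (h.nu_pos r hr) 2
  by_contra! hneg
  have h3 : t r ^ 3 < 0 := Odd.pow_neg (by decide) hneg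
  have := mul_neg_of_neg_of_pos h3 h2
  norm_num at h1
  linarith

theorem t_pos {r : ℝ} (hr : 0 < r) : 0 < t r := by
  refine (h.t_nonneg hr.le).lt_of_ne fun h0 => ?_
  have hmin : IsLocalMin t r := by
    filter_upwards [Ioi_mem_nhds hr] with u hu
    rw [← h0]
    exact h.t_nonneg (le_of_lt hu)
  have := hmin.hasDerivAt_eq_zero (h.hasDerivAt_t hr)
  simp [← h0] at this

theorem nu_zero_lt {r : ℝ} (hr : 0 < r) : ν₀ ^ 2 < ν r ^ 2 := by
  have hmono : StrictMonoOn (fun r => ν r ^ 2) (Ici 0) := by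
    refine strictMonoOn_of_hasDerivWithinAt_pos (f' := fun r => 6 * t r)
      (convex_Ici 0) h.continuousOn_nu_sq ?_ ?_
    · intro r hr
      rw [interior_Ici, mem_Ioi] at hr
      exact (h.hasDerivAt_nu_sq hr).hasDerivWithinAt
    · intro r hr
      rw [interior_Ici, mem_Ioi] at hr
      exact mul_pos (by norm_num) (h.t_pos hr)
  simpa [h.nu_zero] using hmono (mem_Ici.2 le_rfl) (mem_Ici.2 hr.le) hr

/-- The functions `t(r) / r` and `(ν(r)² - ν₀²) / (3 r²)` are smooth functions of the point `v` with
`|v| = r`. This is a bootstrap: `t(|v|) / |v|` is the average of `t'` over the ray to `v`, and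
the differentials of `ν(|v|)²` and `t(|v|)²` are smooth multiples of `⟨v, ·⟩` as soon as this
average is. -/
theorem exists_smooth_quotients (V : Type) [NormedAddCommGroup V] [InnerProductSpace ℝ V]
    [ProperSpace V] : ∃ τ q : V → ℝ, ContDiff ℝ ∞ τ ∧ ContDiff ℝ ∞ q ∧
      (∀ v, t ‖v‖ = ‖v‖ * τ v) ∧ (∀ v, ν ‖v‖ ^ 2 - ν₀ ^ 2 = 3 * (‖v‖ ^ 2 * q v)) ∧
      τ 0 = 1 ∧ q 0 = 1 := by
  have hcomp : ∀ {f : ℝ → ℝ}, ContinuousOn f (Ici 0) → Continuous fun v : V => f ‖v‖ := fun hf =>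
    hf.comp_continuous continuous_norm norm_nonneg
  set N : V → ℝ := fun v => ν ‖v‖ ^ 2 with hN
  set P : V → ℝ := fun v => t ‖v‖ ^ 2 with hP
  have hN0 : ∀ v, N v ≠ 0 := fun v => h.nu_sq_ne_zero (norm_nonneg v)
  set τ : V → ℝ := fun v => ∫ s in (0 : ℝ)..1, s ^ 0 • (1 - 2 * P (s • v) / N (s • v)) with hτ
  have hnorm : ∀ (v : V), ∀ s ∈ uIcc (0 : ℝ) 1, ‖s • v‖ = s * ‖v‖ := by
    intro v s hs
    rw [uIcc_of_le zero_le_one] at hs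
    rw [norm_smul, Real.norm_of_nonneg hs.1]
  have htτ : ∀ v, t ‖v‖ = ‖v‖ * τ v := by
    intro v
    rw [eq_mul_integral_of_hasDerivWithinAt h.deriv_t ?_ h.t_zero (norm_nonneg v)]
    · congr 1
      refine intervalIntegral.integral_congr fun s hs => ?_
      simp only [hP, hN, hnorm v s hs, pow_zero, one_smul]
    · exact continuousOn_const.sub ((continuousOn_const.mul (h.continuousOn_t.pow 2)).div
        h.continuousOn_nu_sq fun r hr => h.nu_sq_ne_zero hr)
  have hdN : ∀ v, HasFDerivAt N ((6 * τ v) • innerSL ℝ v) v := fun v =>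
    hasFDerivAt_comp_norm (f := fun r => ν r ^ 2) (h.deriv_nu _ (norm_nonneg v))
      (by rw [htτ]; ring)
  have hdP : ∀ v, HasFDerivAt P ((2 * τ v * (1 - 2 * P v / N v)) • innerSL ℝ v) v := fun v =>
    hasFDerivAt_comp_norm (f := fun r => t r ^ 2) ((h.deriv_t _ (norm_nonneg v)).pow 2)
      (by simp only [hP, hN, htτ]; ring)
  have hmain : ∀ n : ℕ, ContDiff ℝ n N ∧ ContDiff ℝ n P ∧ ContDiff ℝ n τ := by
    intro n
    have hstep : ∀ m : ℕ, ContDiff ℝ m N → ContDiff ℝ m P → ContDiff ℝ m τ := fun m hNm hPm =>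
      contDiff_integral_smul_comp_smul m
        (contDiff_const.sub ((contDiff_const.mul hPm).div hNm hN0)) 0
    induction n with
    | zero =>
      have h1 : ContDiff ℝ (0 : ℕ) N := contDiff_zero.2 (hcomp h.continuousOn_nu_sq)
      have h2 : ContDiff ℝ (0 : ℕ) P := contDiff_zero.2 (hcomp (h.continuousOn_t.pow 2))
      exact ⟨h1, h2, hstep 0 h1 h2⟩
    | succ n ih =>
      obtain ⟨h1, h2, h3⟩ := ih
      have hinner : ContDiff ℝ n (fun v : V => innerSL ℝ v) := (innerSL ℝ).contDiff
      have h4 : ContDiff ℝ (n + 1 : ℕ) N := by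
        rw [Nat.cast_succ, contDiff_succ_iff_hasFDerivAt]
        exact ⟨_, (contDiff_const.mul h3).smul hinner, hdN⟩
      have h5 : ContDiff ℝ (n + 1 : ℕ) P := by
        rw [Nat.cast_succ, contDiff_succ_iff_hasFDerivAt]
        exact ⟨_, ((contDiff_const.mul h3).mul
          (contDiff_const.sub ((contDiff_const.mul h2).div h1 hN0))).smul hinner, hdP⟩
      exact ⟨h4, h5, hstep _ h4 h5⟩
  have hτ0 : τ 0 = 1 := by simp [hτ, hP, h.t_zero]
  have hτs : ContDiff ℝ ∞ τ := contDiff_infty.2 fun n => (hmain n).2.2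
  refine ⟨τ, fun v => ∫ s in (0 : ℝ)..1, s ^ 1 • (2 * τ (s • v)), hτs,
    contDiff_infty.2 fun n => contDiff_integral_smul_comp_smul n
      (contDiff_const.mul (hmain n).2.2) 1, htτ, fun v => ?_, hτ0, ?_⟩
  · have h1 := eq_mul_integral_of_hasDerivWithinAt (f := fun r => ν r ^ 2 - ν₀ ^ 2)
      (f' := fun r => 6 * t r) (fun r hr => (h.deriv_nu r hr).sub_const _)
      (continuousOn_const.mul h.continuousOn_t) (by simp [h.nu_zero]) (norm_nonneg v)
    rw [h1, sq, ← intervalIntegral.integral_const_mul, ← intervalIntegral.integral_const_mul,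
      ← intervalIntegral.integral_const_mul]
    refine intervalIntegral.integral_congr fun s hs => ?_
    simp only [← hnorm v s hs, htτ, smul_eq_mul, pow_one]
    rw [hnorm v s hs]
    ring
  · simp [hτ0]

end IsProfile

/-! ### The instanton equation for the radial function -/

theorem eq_zero_of_hasDerivAt_mul {a d : ℝ → ℝ} (ha : ContinuousOn a (Ioi 0))
    (hd : ∀ r, 0 < r → HasDerivAt d (a r * d r) r) {r₀ r : ℝ} (hr₀ : 0 < r₀) (h0 : d r₀ = 0)
    (hr : 0 < r) : d r = 0 := by
  set B : ℝ → ℝ := fun r => ∫ s in r₀..r, a s with hB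
  have hBd : ∀ r, 0 < r → HasDerivAt B (a r) r := by
    intro r hr
    have hcont : ContinuousOn a (uIcc r₀ r) := ha.mono fun s hs =>
      (lt_min hr₀ hr).trans_le hs.1
    exact intervalIntegral.integral_hasDerivAt_right hcont.intervalIntegrable
      (ha.stronglyMeasurableAtFilter isOpen_Ioi r hr) (ha.continuousAt (Ioi_mem_nhds hr))
  have hprod : ∀ r, 0 < r → HasDerivAt (fun r => Real.exp (-B r) * d r) 0 r := by
    intro r hr
    refine ((hBd r hr).neg.exp.mul (hd r hr)).congr_deriv ?_
    simp only [Pi.neg_apply]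
    ring
  have hconst := isOpen_Ioi.is_const_of_deriv_eq_zero (isPreconnected_Ioi)
    (fun r hr => (hprod r hr).differentiableAt.differentiableWithinAt)
    (fun r hr => (hprod r hr).deriv) (mem_Ioi.2 hr) (mem_Ioi.2 hr₀)
  simpa [h0, (Real.exp_pos _).ne'] using hconst

/-- In terms of `1 / x` the instanton equation becomes linear: the function
`t² / x - (ν² - ν₀²) / 3` is constant. Its value `C` is determined by the behaviour of `x` at
`r = 0`. -/
theorem IsProfile.radial_solution {ν₀ : ℝ} {t ν : ℝ → ℝ} (h : IsProfile ν₀ t ν) {x : ℝ → ℝ}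
    (hx : ∀ r, 0 < r →
      HasDerivAt x (2 * x r * (1 - x r) / t r - 4 * x r * t r / ν r ^ 2) r)
    {C : ℝ} (hne : ∀ᶠ r in 𝓝[>] 0, x r ≠ 0)
    (hC : Tendsto (fun r => t r ^ 2 / x r) (𝓝[>] 0) (𝓝 C)) {r : ℝ} (hr : 0 < r) :
    x r * (C + (ν r ^ 2 - ν₀ ^ 2) / 3) = t r ^ 2 := by
  set Q : ℝ → ℝ := fun r => (ν r ^ 2 - ν₀ ^ 2) / 3 with hQ
  have hQd : ∀ r, 0 < r → HasDerivAt Q (2 * t r) r := fun r hr =>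
    (((h.hasDerivAt_nu_sq hr).sub_const _).div_const 3).congr_deriv (by ring)
  obtain ⟨δ, hδ, hδx⟩ := mem_nhdsGT_iff_exists_Ioo_subset.1 hne
  rw [mem_Ioi] at hδ
  have hkd : ∀ r ∈ Ioo 0 δ, HasDerivAt (fun r => t r ^ 2 / x r - Q r) 0 r := by
    intro r hr
    have hxr : x r ≠ 0 := hδx hr
    have ht := (h.t_pos hr.1).ne'
    have hν := (h.nu_pos r hr.1.le).ne'
    refine ((((h.hasDerivAt_t hr.1).pow 2).div (hx r hr.1) hxr).sub (hQd r hr.1)).congr_deriv ?_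
    simp only [Pi.pow_apply]
    field_simp
    push_cast
    ring
  have hmid : δ / 2 ∈ Ioo 0 δ := ⟨by linarith, by linarith⟩
  have hconst : ∀ r ∈ Ioo 0 δ, t r ^ 2 / x r - Q r = t (δ / 2) ^ 2 / x (δ / 2) - Q (δ / 2) :=
    fun r hr => isOpen_Ioo.is_const_of_deriv_eq_zero isPreconnected_Ioo
      (fun r hr => (hkd r hr).differentiableAt.differentiableWithinAt)
      (fun r hr => (hkd r hr).deriv) hr hmid
  have hQ0 : Tendsto Q (𝓝[>] 0) (𝓝 0) := by
    have h1 : ContinuousWithinAt (fun r => (ν r ^ 2 - ν₀ ^ 2) / 3) (Ici 0) 0 :=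
      ((h.continuousOn_nu_sq 0 (mem_Ici.2 le_rfl)).sub continuousWithinAt_const).div_const 3
    have h2 := h1.tendsto.mono_left (nhdsWithin_mono 0 Ioi_subset_Ici_self)
    simpa [h.nu_zero] using h2
  have hCval : C = t (δ / 2) ^ 2 / x (δ / 2) - Q (δ / 2) := by
    have h1 : Tendsto (fun r => t r ^ 2 / x r - Q r) (𝓝[>] 0) (𝓝 C) := by
      simpa using hC.sub hQ0
    refine tendsto_nhds_unique h1 (tendsto_const_nhds.congr' ?_)
    filter_upwards [Ioo_mem_nhdsGT hδ] with r hr using (hconst r hr).symm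
  have hxc : ContinuousOn x (Ioi 0) := fun r hr => (hx r hr).continuousAt.continuousWithinAt
  have htc : ContinuousOn t (Ioi 0) := h.continuousOn_t.mono Ioi_subset_Ici_self
  have hνc : ContinuousOn (fun r => ν r ^ 2) (Ioi 0) :=
    h.continuousOn_nu_sq.mono Ioi_subset_Ici_self
  have hmain := eq_zero_of_hasDerivAt_mul
    (a := fun r => (2 - 2 * x r) / t r - 4 * t r / ν r ^ 2)
    (d := fun r => x r * (C + Q r) - t r ^ 2)
    (((continuousOn_const.sub (continuousOn_const.mul hxc)).div htc
      fun r hr => (h.t_pos hr).ne').sub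
      ((continuousOn_const.mul htc).div hνc fun r hr => h.nu_sq_ne_zero (le_of_lt hr)))
    (fun r hr => ?_) hmid.1 ?_ hr
  · exact sub_eq_zero.1 hmain
  · have ht := (h.t_pos hr).ne'
    have hν := (h.nu_pos r hr.le).ne'
    refine (((hx r hr).mul ((hQd r hr).const_add C)).sub
      ((h.hasDerivAt_t hr).pow 2)).congr_deriv ?_
    field_simp
    push_cast
    ring
  · have hxr : x (δ / 2) ≠ 0 := hδx hmid
    rw [hCval]
    field_simp
    ring

/-! ### Linear algebra at a point of `X` -/

/-- The basis `T₁ = i`, `T₂ = j`, `T₃ = k` of the Lie algebra. -/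
noncomputable def imUnit (i : Fin 3) : ℍ[ℝ] :=
  ⟨0, ![1, 0, 0] i, ![0, 1, 0] i, ![0, 0, 1] i⟩

theorem imComp_imUnit (i j : Fin 3) : imComp i (imUnit j) = if i = j then 1 else 0 := by
  fin_cases i <;> fin_cases j <;> rfl

/-- The component `imComp i` as a linear map. -/
noncomputable def imCompₗ (i : Fin 3) : ℍ[ℝ] →ₗ[ℝ] ℝ where
  toFun := imComp i
  map_add' a b := by fin_cases i <;> simp [imComp]
  map_smul' a b := by fin_cases i <;> simp [imComp]

theorem imComp_add (i : Fin 3) (a b : ℍ[ℝ]) : imComp i (a + b) = imComp i a + imComp i b :=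
  (imCompₗ i).map_add a b

theorem imComp_sub (i : Fin 3) (a b : ℍ[ℝ]) : imComp i (a - b) = imComp i a - imComp i b :=
  (imCompₗ i).map_sub a b

theorem imComp_neg (i : Fin 3) (a : ℍ[ℝ]) : imComp i (-a) = -imComp i a :=
  (imCompₗ i).map_neg a

theorem imComp_smul (i : Fin 3) (c : ℝ) (a : ℍ[ℝ]) : imComp i (c • a) = c * imComp i a :=
  (imCompₗ i).map_smul c a

theorem imComp_sum {ι : Type*} (s : Finset ι) (i : Fin 3) (f : ι → ℍ[ℝ]) :
    imComp i (∑ a ∈ s, f a) = ∑ a ∈ s, imComp i (f a) :=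
  map_sum (imCompₗ i) f s

namespace ThreeSasakian

variable {X : Type*} [TopologicalSpace X] [ChartedSpace (EuclideanSpace ℝ (Fin 7)) X]
  (S : ThreeSasakian X)

theorem exists_vertical (p : X) {q : ℍ[ℝ]} (hq : q.re = 0) :
    ∃ V : TangentSpace (𝓡 7) p, S.η p V = q ∧ ∀ W, S.h p V W = 0 := by
  have key : ∀ p', p' = S.act p 1 →
      ∃ V : TangentSpace (𝓡 7) p', S.η p' V = q ∧ ∀ W, S.h p' V W = 0 := by
    rintro _ rfl
    have hmem : q ∈ (ℝ ∙ (((1 : SU2) : ℍ[ℝ])))ᗮ := by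
      rw [Submodule.mem_orthogonal_singleton_iff_inner_right, Quaternion.inner_def]
      simp [hq]
    rw [← range_mvfderiv_subtypeVal (n := 3)] at hmem
    obtain ⟨ξ, hξ⟩ := hmem
    refine ⟨mfderiv (𝓡 3) (𝓡 7) (S.act p) 1 ξ, ?_, fun W => S.h_orbit p 1 ξ W⟩
    rw [S.eta_orbit p 1 ξ]
    simpa using hξ
  exact key p (S.act_one p).symm

/-- A frame of `T_p X` adapted to the splitting into the vertical directions and `ker η`. -/
structure AdaptedFrame (p : X) where
  /-- the vertical vectors dual to the `η_i` -/
  vert : Fin 3 → TangentSpace (𝓡 7) p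
  /-- the horizontal vectors -/
  hor : Fin 4 → TangentSpace (𝓡 7) p
  eta_vert : ∀ i, S.η p (vert i) = imUnit i
  h_vert : ∀ i W, S.h p (vert i) W = 0
  eta_hor : ∀ a, S.η p (hor a) = 0
  h_hor : ∀ a b, S.h p (hor a) (hor b) = if a = b then 1 else 0
  curvature_eq : ∀ U V : TangentSpace (𝓡 7) p, OneForm.curvature (𝓡 7) S.η p U V =
      (-(S.s / 24)) • (⟨0,
        wedge11 (fun W => S.h p (hor 0) W) (fun W => S.h p (hor 1) W) U V
          + wedge11 (fun W => S.h p (hor 2) W) (fun W => S.h p (hor 3) W) U V,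
        wedge11 (fun W => S.h p (hor 0) W) (fun W => S.h p (hor 2) W) U V
          + wedge11 (fun W => S.h p (hor 3) W) (fun W => S.h p (hor 1) W) U V,
        wedge11 (fun W => S.h p (hor 0) W) (fun W => S.h p (hor 3) W) U V
          + wedge11 (fun W => S.h p (hor 1) W) (fun W => S.h p (hor 2) W) U V⟩ : ℍ[ℝ])

theorem nonempty_adaptedFrame (p : X) : Nonempty (S.AdaptedFrame p) := by
  obtain ⟨e, he, hh, hc⟩ := S.curvature_eq p
  choose V hV hV' using fun i : Fin 3 => S.exists_vertical p (q := imUnit i) rfl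
  exact ⟨⟨V, e, hV, hV', he, hh, hc⟩⟩

namespace AdaptedFrame

variable {S} {p : X} (f : S.AdaptedFrame p)

/-- The vertical and horizontal vectors together are a basis, since they are seven vectors with
linearly independent images under `(η, h(hor a, ·))`. -/
theorem eq_sum (U : TangentSpace (𝓡 7) p) :
    U = ∑ i, imComp i (S.η p U) • f.vert i + ∑ a, S.h p (f.hor a) U • f.hor a := by
  have : FiniteDimensional ℝ (TangentSpace (𝓡 7) p) :=
    inferInstanceAs (FiniteDimensional ℝ (EuclideanSpace ℝ (Fin 7)))
  have hrank : Module.finrank ℝ (TangentSpace (𝓡 7) p) = 7 :=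
    finrank_euclideanSpace_fin (𝕜 := ℝ) (n := 7)
  let L : TangentSpace (𝓡 7) p →ₗ[ℝ] (Fin 3 → ℝ) × (Fin 4 → ℝ) :=
    LinearMap.prod (LinearMap.pi fun i => imCompₗ i ∘ₗ (S.η p).toLinearMap)
      (LinearMap.pi fun a => (S.h p (f.hor a)).toLinearMap)
  have hL : ∀ c d, L (∑ i, c i • f.vert i + ∑ a, d a • f.hor a) = (c, d) := by
    intro c d
    have h1 : ∀ i, L (f.vert i) = (Pi.single i 1, 0) := by
      intro i
      refine Prod.ext (funext fun j => ?_) (funext fun a => ?_)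
      · change imComp j (S.η p (f.vert i)) = _
        rw [f.eta_vert, imComp_imUnit]
        exact (Pi.single_apply ..).symm
      · change S.h p (f.hor a) (f.vert i) = 0
        rw [S.h_symm, f.h_vert]
    have h2 : ∀ a, L (f.hor a) = (0, Pi.single a 1) := by
      intro a
      refine Prod.ext (funext fun j => ?_) (funext fun b => ?_)
      · change imComp j (S.η p (f.hor a)) = _
        rw [f.eta_hor]
        exact (imCompₗ j).map_zero
      · change S.h p (f.hor b) (f.hor a) = _
        rw [f.h_hor]
        exact (Pi.single_apply ..).symm
    simp only [map_add, map_sum, map_smul, h1, h2]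
    refine Prod.ext (funext fun j => ?_) (funext fun b => ?_) <;>
      simp [Prod.fst_sum, Prod.snd_sum, Finset.sum_apply, Pi.single_apply]
  have hinj : Function.Injective L := by
    rw [LinearMap.injective_iff_surjective_of_finrank_eq_finrank (by simp [hrank])]
    rintro ⟨c, d⟩
    exact ⟨_, hL c d⟩
  exact hinj (hL (fun i => imComp i (S.η p U)) (fun a => S.h p (f.hor a) U)).symm

theorem h_eq_sum (U W : TangentSpace (𝓡 7) p) :
    S.h p U W = ∑ a, S.h p (f.hor a) U * S.h p (f.hor a) W := by
  have h2 := congrArg (fun U' => S.h p U' W) (f.eq_sum U)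
  simpa [f.h_vert] using h2

end AdaptedFrame

/-- The horizontal form `h` is positive semidefinite. -/
theorem h_self_nonneg (p : X) (U : TangentSpace (𝓡 7) p) : 0 ≤ S.h p U U := by
  obtain ⟨f⟩ := S.nonempty_adaptedFrame p
  rw [f.h_eq_sum]
  exact Finset.sum_nonneg fun a _ => mul_self_nonneg _

end ThreeSasakian

/-! ### Charts of `X × V` -/

section ProductChart

variable {X : Type*} [TopologicalSpace X] [ChartedSpace (EuclideanSpace ℝ (Fin 7)) X]
  {V : Type*} [NormedAddCommGroup V] [NormedSpace ℝ V]

theorem extChartAt_prod_vectorSpace (m : X × V) :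
    extChartAt ((𝓡 7).prod 𝓘(ℝ, V)) m =
      (extChartAt (𝓡 7) m.1).prod (PartialEquiv.refl V) := by
  rw [extChartAt_prod, extChartAt_model_space_eq_id]

theorem mem_extChartAt_prod_target {m : X × V} {y : EuclideanSpace ℝ (Fin 7) × V} :
    y ∈ (extChartAt ((𝓡 7).prod 𝓘(ℝ, V)) m).target ↔ y.1 ∈ (extChartAt (𝓡 7) m.1).target := by
  rw [extChartAt_prod_vectorSpace, PartialEquiv.prod_target, mem_prod]
  exact and_iff_left (mem_univ _)

theorem extChartAt_prod_symm_apply (m : X × V) (y : EuclideanSpace ℝ (Fin 7) × V) :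
    (extChartAt ((𝓡 7).prod 𝓘(ℝ, V)) m).symm y = ((extChartAt (𝓡 7) m.1).symm y.1, y.2) := by
  rw [extChartAt_prod_vectorSpace]
  rfl

variable [IsManifold (𝓡 7) ∞ X]

theorem mdifferentiableAt_extChartAt_symm {m : X} {y : EuclideanSpace ℝ (Fin 7)}
    (hy : y ∈ (extChartAt (𝓡 7) m).target) :
    MDifferentiableAt 𝓘(ℝ, EuclideanSpace ℝ (Fin 7)) (𝓡 7) (extChartAt (𝓡 7) m).symm y := by
  have h := mdifferentiableWithinAt_extChartAt_symm hy
  rwa [ModelWithCorners.range_eq_univ, mdifferentiableWithinAt_univ] at h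

theorem mdifferentiableAt_extChartAt_prod_symm {m : X × V} {y : EuclideanSpace ℝ (Fin 7) × V}
    (hy : y ∈ (extChartAt ((𝓡 7).prod 𝓘(ℝ, V)) m).target) :
    MDifferentiableAt 𝓘(ℝ, EuclideanSpace ℝ (Fin 7) × V) ((𝓡 7).prod 𝓘(ℝ, V))
      (extChartAt ((𝓡 7).prod 𝓘(ℝ, V)) m).symm y := by
  have h := mdifferentiableWithinAt_extChartAt_symm hy
  rwa [ModelWithCorners.range_eq_univ, mdifferentiableWithinAt_univ] at h

theorem mfderiv_extChartAt_symm_self (m : X) :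
    mfderiv 𝓘(ℝ, EuclideanSpace ℝ (Fin 7)) (𝓡 7) (extChartAt (𝓡 7) m).symm
      (extChartAt (𝓡 7) m m) = ContinuousLinearMap.id ℝ (EuclideanSpace ℝ (Fin 7)) := by
  have h := mfderivWithin_range_extChartAt_symm (I := 𝓡 7) (x := m)
  rwa [ModelWithCorners.range_eq_univ, mfderivWithin_univ] at h

/-- In product charts, the differential of the projection to `X` is the differential of the
projection of the model spaces. -/
theorem mfderiv_fst_mfderiv_extChartAt_prod_symm {m : X × V} {y : EuclideanSpace ℝ (Fin 7) × V}
    (hy : y ∈ (extChartAt ((𝓡 7).prod 𝓘(ℝ, V)) m).target)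
    (u : EuclideanSpace ℝ (Fin 7) × V) :
    mfderiv ((𝓡 7).prod 𝓘(ℝ, V)) (𝓡 7) (Prod.fst : X × V → X)
        ((extChartAt ((𝓡 7).prod 𝓘(ℝ, V)) m).symm y)
        (mfderiv 𝓘(ℝ, EuclideanSpace ℝ (Fin 7) × V) ((𝓡 7).prod 𝓘(ℝ, V))
          (extChartAt ((𝓡 7).prod 𝓘(ℝ, V)) m).symm y u) =
      mfderiv 𝓘(ℝ, EuclideanSpace ℝ (Fin 7)) (𝓡 7) (extChartAt (𝓡 7) m.1).symm y.1 u.1 := by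
  have hy1 := mem_extChartAt_prod_target.1 hy
  have h1 := mfderiv_comp_apply y (g := (Prod.fst : X × V → X))
    (f := (extChartAt ((𝓡 7).prod 𝓘(ℝ, V)) m).symm) (I := 𝓘(ℝ, EuclideanSpace ℝ (Fin 7) × V))
    mdifferentiableAt_fst (mdifferentiableAt_extChartAt_prod_symm hy) u
  have h2 : (Prod.fst : X × V → X) ∘ (extChartAt ((𝓡 7).prod 𝓘(ℝ, V)) m).symm =
      (extChartAt (𝓡 7) m.1).symm ∘ Prod.fst := by
    funext z
    exact congrArg Prod.fst (extChartAt_prod_symm_apply m z)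
  have h3 := mfderiv_comp_apply y (g := (extChartAt (𝓡 7) m.1).symm)
    (f := (Prod.fst : EuclideanSpace ℝ (Fin 7) × V → EuclideanSpace ℝ (Fin 7)))
    (I := 𝓘(ℝ, EuclideanSpace ℝ (Fin 7) × V)) (mdifferentiableAt_extChartAt_symm hy1)
    differentiableAt_fst.mdifferentiableAt u
  rw [mfderiv_eq_fderiv, fderiv_fst] at h3
  rw [← h1, h2]
  exact h3

end ProductChart

/-! ### The curvature of a radial connection -/

namespace ThreeSasakian

variable {X : Type*} [TopologicalSpace X] [ChartedSpace (EuclideanSpace ℝ (Fin 7)) X]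
  (S : ThreeSasakian X)

theorem dX_apply (q : X × ℝ) (a : EuclideanSpace ℝ (Fin 7) × ℝ) : dX q a = a.1 := by
  rw [dX, mfderiv_fst]
  rfl

theorem dr_apply (q : X × ℝ) (a : EuclideanSpace ℝ (Fin 7) × ℝ) : dr q a = a.2 := by
  rw [dr, mvfderiv, mfderiv_snd]
  rfl

theorem inChart_congr {α β : OneForm IC (X × ℝ) ℍ[ℝ]} {m : X × ℝ}
    {y : EuclideanSpace ℝ (Fin 7) × ℝ}
    (hαβ : α ((extChartAt IC m).symm y) = β ((extChartAt IC m).symm y)) :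
    OneForm.inChart IC α m y = OneForm.inChart IC β m y := by
  rw [OneForm.inChart, OneForm.inChart, hαβ]

theorem differentiableAt_inChart_eta (p : X) {y : EuclideanSpace ℝ (Fin 7)}
    (hy : y ∈ (extChartAt (𝓡 7) p).target) :
    DifferentiableAt ℝ (OneForm.inChart (𝓡 7) S.η p) y :=
  ((S.eta_smooth p).differentiableOn (by simp)).differentiableAt
    ((isOpen_extChartAt_target p).mem_nhds hy)

variable [IsManifold (𝓡 7) ∞ X]

theorem inChart_radialForm (x : ℝ → ℝ) (q : X × ℝ) {y : EuclideanSpace ℝ (Fin 7) × ℝ}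
    (hy : y ∈ (extChartAt IC q).target) :
    OneForm.inChart IC (S.radialForm x) q y =
      x y.2 • (OneForm.inChart (𝓡 7) S.η q.1 y.1).comp
        (ContinuousLinearMap.fst ℝ (EuclideanSpace ℝ (Fin 7)) ℝ) := by
  refine ContinuousLinearMap.ext fun u => ?_
  have h1 := mfderiv_fst_mfderiv_extChartAt_prod_symm hy u
  change x ((extChartAt IC q).symm y).2 • S.η ((extChartAt IC q).symm y).1
    (mfderiv IC (𝓡 7) (Prod.fst : X × ℝ → X) ((extChartAt IC q).symm y)
      (mfderiv 𝓘(ℝ, EuclideanSpace ℝ (Fin 7) × ℝ) IC (extChartAt IC q).symm y u)) = _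
  rw [h1, extChartAt_prod_symm_apply]
  rfl

theorem inChart_eta_self (p : X) (u : EuclideanSpace ℝ (Fin 7)) :
    OneForm.inChart (𝓡 7) S.η p (extChartAt (𝓡 7) p p) u = S.η p u := by
  have h1 := mfderiv_extChartAt_symm_self p
  have h2 : (extChartAt (𝓡 7) p).symm (extChartAt (𝓡 7) p p) = p := extChartAt_to_inv p
  have h3 : ∀ (p' : X) (w : EuclideanSpace ℝ (Fin 7)), p' = p → S.η p' w = S.η p w := by
    rintro _ _ rfl
    rfl
  change S.η _ (mfderiv 𝓘(ℝ, EuclideanSpace ℝ (Fin 7)) (𝓡 7) (extChartAt (𝓡 7) p).symm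
      (extChartAt (𝓡 7) p p) u) = _
  refine (h3 _ _ h2).trans ?_
  rw [h1]
  rfl

theorem extD_radialForm {x : ℝ → ℝ} {x' : ℝ} (q : X × ℝ) (hx : HasDerivAt x x' q.2)
    (u v : EuclideanSpace ℝ (Fin 7) × ℝ) :
    OneForm.extD IC (S.radialForm x) q u v =
      x' • (u.2 • S.η q.1 v.1 - v.2 • S.η q.1 u.1)
        + x q.2 • OneForm.extD (𝓡 7) S.η q.1 u.1 v.1 := by
  set y₀ := extChartAt IC q q with hy₀
  have hmem : y₀ ∈ (extChartAt IC q).target := mem_extChartAt_target q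
  have hy₀1 : y₀.1 = extChartAt (𝓡 7) q.1 q.1 := by rw [hy₀, extChartAt_prod_vectorSpace]; rfl
  have hy₀2 : y₀.2 = q.2 := by rw [hy₀, extChartAt_prod_vectorSpace]; rfl
  have heq : OneForm.inChart IC (S.radialForm x) q =ᶠ[𝓝 y₀] fun y =>
      x y.2 • (OneForm.inChart (𝓡 7) S.η q.1 y.1).comp
        (ContinuousLinearMap.fst ℝ (EuclideanSpace ℝ (Fin 7)) ℝ) :=
    eventually_of_mem ((isOpen_extChartAt_target q).mem_nhds hmem)
      fun y hy => S.inChart_radialForm x q hy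
  have hB : HasFDerivAt (OneForm.inChart (𝓡 7) S.η q.1)
      (fderiv ℝ (OneForm.inChart (𝓡 7) S.η q.1) y₀.1) y₀.1 :=
    (S.differentiableAt_inChart_eta q.1 (mem_extChartAt_prod_target.1 hmem)).hasFDerivAt
  have hB' := (hB.comp y₀ hasFDerivAt_fst).clm_comp
    (hasFDerivAt_const (ContinuousLinearMap.fst ℝ (EuclideanSpace ℝ (Fin 7)) ℝ) y₀)
  have hx' : HasFDerivAt (fun y : EuclideanSpace ℝ (Fin 7) × ℝ => x y.2) _ y₀ :=
    (hy₀2 ▸ hx : HasDerivAt x x' y₀.2).hasFDerivAt.comp y₀ hasFDerivAt_snd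
  have hfd := ((hx'.smul hB').congr_of_eventuallyEq heq).fderiv
  have hself : ∀ w, OneForm.inChart (𝓡 7) S.η q.1 y₀.1 w = S.η q.1 w := by
    intro w
    rw [hy₀1]
    exact S.inChart_eta_self q.1 w
  have key : ∀ u v : EuclideanSpace ℝ (Fin 7) × ℝ,
      (fderiv ℝ (OneForm.inChart IC (S.radialForm x) q) y₀ u) v =
        (x' * u.2) • S.η q.1 v.1 +
          x q.2 • (fderiv ℝ (OneForm.inChart (𝓡 7) S.η q.1) (extChartAt (𝓡 7) q.1 q.1) u.1)
            v.1 := by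
    intro u v
    rw [hfd, ← hy₀1, ← hy₀2, ← hself]
    simp [mul_comm, add_comm]
  refine (congrArg₂ (· - ·) (key u v) (key v u)).trans ?_
  change _ = x' • (u.2 • S.η q.1 v.1 - v.2 • S.η q.1 u.1) + x q.2 •
    ((fderiv ℝ (OneForm.inChart (𝓡 7) S.η q.1) (extChartAt (𝓡 7) q.1 q.1) u.1) v.1 -
      (fderiv ℝ (OneForm.inChart (𝓡 7) S.η q.1) (extChartAt (𝓡 7) q.1 q.1) v.1) u.1)
  module

/-- The curvature `x' dr ∧ η + x F_η + (x² - x) ½ [η ∧ η]` of `x η`. -/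
theorem curvature_radialForm {x : ℝ → ℝ} {x' : ℝ} (q : X × ℝ) (hx : HasDerivAt x x' q.2)
    (u v : EuclideanSpace ℝ (Fin 7) × ℝ) :
    OneForm.curvature IC (S.radialForm x) q u v =
      x' • (u.2 • S.η q.1 v.1 - v.2 • S.η q.1 u.1)
        + x q.2 • OneForm.curvature (𝓡 7) S.η q.1 u.1 v.1
        + (x q.2 ^ 2 - x q.2) •
          (S.η q.1 u.1 * S.η q.1 v.1 - S.η q.1 v.1 * S.η q.1 u.1) := by
  have happ : ∀ w : EuclideanSpace ℝ (Fin 7) × ℝ, S.radialForm x q w = x q.2 • S.η q.1 w.1 := by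
    intro w
    change x q.2 • S.η q.1 (dX q w) = _
    rw [dX_apply]
  have h1 : OneForm.curvature IC (S.radialForm x) q u v =
      OneForm.extD IC (S.radialForm x) q u v +
        (S.radialForm x q u * S.radialForm x q v - S.radialForm x q v * S.radialForm x q u) := rfl
  have h2 : OneForm.curvature (𝓡 7) S.η q.1 u.1 v.1 = OneForm.extD (𝓡 7) S.η q.1 u.1 v.1 +
        (S.η q.1 u.1 * S.η q.1 v.1 - S.η q.1 v.1 * S.η q.1 u.1) := rfl
  rw [h1, h2, S.extD_radialForm q hx, happ, happ, smul_mul_smul_comm, smul_mul_smul_comm]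
  module

end ThreeSasakian

/-! ### The instanton equation in an adapted frame -/

section Coframe

variable {W : Type*} [AddCommGroup W] [Module ℝ W]

/-- The frame of `W × ℝ` consisting of `∂_r`, the vectors `T⁻¹ V_i` and the vectors `ρ⁻¹ e_a`. -/
noncomputable def scaledFrame (V : Fin 3 → W) (e : Fin 4 → W) (T ρ : ℝ) : Fin 8 → W × ℝ :=
  ![(0, 1), (T⁻¹ • V 0, 0), (T⁻¹ • V 1, 0), (T⁻¹ • V 2, 0), (ρ⁻¹ • e 0, 0), (ρ⁻¹ • e 1, 0),
    (ρ⁻¹ • e 2, 0), (ρ⁻¹ • e 3, 0)]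

/-- The coframe of `W × ℝ` consisting of `dr`, the one-forms `T η_i` and the one-forms `ρ h_a`. -/
noncomputable def scaledCoframe (η : Fin 3 → W →ₗ[ℝ] ℝ) (h : Fin 4 → W →ₗ[ℝ] ℝ) (T ρ : ℝ) :
    Fin 8 → W × ℝ → ℝ :=
  ![fun w => w.2, fun w => T * η 0 w.1, fun w => T * η 1 w.1, fun w => T * η 2 w.1,
    fun w => ρ * h 0 w.1, fun w => ρ * h 1 w.1, fun w => ρ * h 2 w.1, fun w => ρ * h 3 w.1]

theorem scaledCoframe_scaledFrame {η : Fin 3 → W →ₗ[ℝ] ℝ} {h : Fin 4 → W →ₗ[ℝ] ℝ}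
    {V : Fin 3 → W} {e : Fin 4 → W} {T ρ : ℝ} (hT : T ≠ 0) (hρ : ρ ≠ 0)
    (hηV : ∀ i j, η i (V j) = if i = j then 1 else 0) (hηe : ∀ i a, η i (e a) = 0)
    (hhV : ∀ a i, h a (V i) = 0) (hhe : ∀ a b, h a (e b) = if a = b then 1 else 0)
    (c j : Fin 8) :
    scaledCoframe η h T ρ c (scaledFrame V e T ρ j) = if c = j then 1 else 0 := by
  fin_cases c <;> fin_cases j <;>
    simp [scaledCoframe, scaledFrame, hηV, hηe, hhV, hhe, hT, hρ]

end Coframe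

/-- The contraction of `θ²³ - θ⁴⁵ - θ⁶⁷` with `A θ⁰¹ + B θ²³ + C (θ⁴⁵ + θ⁶⁷)`, for the dual basis
`θ` of `E`. -/
theorem sum_wedge11_dual {W : Type*} (θ : Fin 8 → W → ℝ) (E : Fin 8 → W)
    (hθ : ∀ c j, θ c (E j) = if c = j then 1 else 0) (A B C : ℝ) :
    ∑ a, ∑ b, (wedge11 (θ 2) (θ 3) (E a) (E b) - wedge11 (θ 4) (θ 5) (E a) (E b)
        - wedge11 (θ 6) (θ 7) (E a) (E b)) *
      (A * wedge11 (θ 0) (θ 1) (E a) (E b) + B * wedge11 (θ 2) (θ 3) (E a) (E b)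
        + C * (wedge11 (θ 4) (θ 5) (E a) (E b) + wedge11 (θ 6) (θ 7) (E a) (E b))) =
      2 * B - 4 * C := by
  simp only [wedge11, hθ]
  simp [Fin.sum_univ_eight, Fin.ext_iff]
  ring

namespace ThreeSasakian

variable {X : Type*} [TopologicalSpace X] [ChartedSpace (EuclideanSpace ℝ (Fin 7)) X]
  (S : ThreeSasakian X)

theorem imComp_zero_commutator (a b : ℍ[ℝ]) :
    imComp 0 (a * b - b * a) = 2 * (imComp 1 a * imComp 2 b - imComp 1 b * imComp 2 a) := by
  simp [imComp]
  ring

theorem AdaptedFrame.omega_zero {p : X} (f : S.AdaptedFrame p) (U W : TangentSpace (𝓡 7) p) :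
    S.omega 0 p U W = wedge11 (fun W => S.h p (f.hor 0) W) (fun W => S.h p (f.hor 1) W) U W
      + wedge11 (fun W => S.h p (f.hor 2) W) (fun W => S.h p (f.hor 3) W) U W := by
  have hs := S.s_pos.ne'
  rw [omega, f.curvature_eq]
  refine (congrArg _ (imComp_smul 0 _ _)).trans ?_
  simp only [imComp, Matrix.cons_val_zero]
  field_simp

theorem AdaptedFrame.omega_eq_zero {p : X} (f : S.AdaptedFrame p) (j : Fin 3)
    {U : TangentSpace (𝓡 7) p} (hU : ∀ a, S.h p (f.hor a) U = 0) (W : TangentSpace (𝓡 7) p) :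
    S.omega j p U W = 0 := by
  rw [omega, f.curvature_eq]
  refine (congrArg _ (imComp_smul j _ _)).trans ?_
  fin_cases j <;> simp [imComp, wedge11, hU]

theorem ηR_apply (i : Fin 3) (q : X × ℝ) (u : EuclideanSpace ℝ (Fin 7) × ℝ) :
    S.ηR i q u = imComp i (S.η q.1 u.1) := by
  change imComp i (S.η q.1 (dX q u)) = _
  rw [dX_apply]

theorem ωR_apply (i : Fin 3) (q : X × ℝ) (u v : EuclideanSpace ℝ (Fin 7) × ℝ) :
    S.ωR i q u v = S.omega i q.1 u.1 v.1 := by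
  change S.omega i q.1 (dX q u) (dX q v) = _
  rw [dX_apply, dX_apply]

theorem gΘ_apply (t ν : ℝ → ℝ) (q : X × ℝ) (u v : EuclideanSpace ℝ (Fin 7) × ℝ) :
    S.gΘ t ν q u v = u.2 * v.2
      + t q.2 ^ 2 * ∑ i, imComp i (S.η q.1 u.1) * imComp i (S.η q.1 v.1)
      + S.s / 48 * ν q.2 ^ 2 * S.h q.1 u.1 v.1 := by
  change dr q u * dr q v + t q.2 ^ 2 * ∑ i, S.ηR i q u * S.ηR i q v
    + S.s / 48 * ν q.2 ^ 2 * S.h q.1 (dX q u) (dX q v) = _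
  simp only [ηR_apply, dX_apply, dr_apply]

variable [IsManifold (𝓡 7) ∞ X]

/-- The equation for `x` is the `T₁`-component of the instanton equation in the plane of `∂_r` and
of the vector dual to `η₁`. -/
theorem radial_equation {t ν x : ℝ → ℝ} {x' : ℝ}
    (hinst : S.IsSpinSevenInstanton t ν (S.radialForm x)) (p : X) {r : ℝ} (hr : 0 < r)
    (ht : 0 < t r) (hν : 0 < ν r) (hx : HasDerivAt x x' r) :
    x' = 2 * x r * (1 - x r) / t r - 4 * x r * t r / ν r ^ 2 := by
  obtain ⟨f⟩ := S.nonempty_adaptedFrame p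
  have hs := S.s_pos
  set ρ : ℝ := √(S.s / 48) * ν r with hρ
  have hρ0 : 0 < ρ := mul_pos (Real.sqrt_pos.2 (by positivity)) hν
  have hρ2 : ρ ^ 2 = S.s / 48 * ν r ^ 2 := by
    rw [hρ, mul_pow, Real.sq_sqrt (by positivity)]
  let W := TangentSpace (𝓡 7) p × ℝ
  let A : Fin 3 → TangentSpace (𝓡 7) p →ₗ[ℝ] ℝ := fun i => imCompₗ i ∘ₗ (S.η p).toLinearMap
  let H : Fin 4 → TangentSpace (𝓡 7) p →ₗ[ℝ] ℝ := fun a => (S.h p (f.hor a)).toLinearMap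
  let E : Fin 8 → W := scaledFrame f.vert f.hor (t r) ρ
  let θ : Fin 8 → W → ℝ := scaledCoframe A H (t r) ρ
  have hθE : ∀ c j, θ c (E j) = if c = j then 1 else 0 := by
    refine scaledCoframe_scaledFrame ht.ne' hρ0.ne' (fun i j => ?_) (fun i a => ?_)
      (fun a i => ?_) fun a b => f.h_hor a b
    · exact (congrArg (imComp i) (f.eta_vert j)).trans (imComp_imUnit i j)
    · exact (congrArg (imComp i) (f.eta_hor a)).trans (imCompₗ i).map_zero
    · exact (S.h_symm p _ _).trans (f.h_vert i _)
  have hg : ∀ u v : W, S.gΘ t ν (p, r) u v = ∑ c, θ c u * θ c v := by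
    intro u v
    have h1 : S.gΘ t ν (p, r) u v = u.2 * v.2 + t r ^ 2 * ∑ i, A i u.1 * A i v.1 +
        S.s / 48 * ν r ^ 2 * ∑ a, H a u.1 * H a v.1 := by
      exact (S.gΘ_apply t ν (p, r) u v).trans
        (congrArg (fun z => _ + S.s / 48 * ν r ^ 2 * z) (f.h_eq_sum u.1 v.1))
    rw [h1, ← hρ2]
    simp [Fin.sum_univ_eight, Fin.sum_univ_three, Fin.sum_univ_four, θ, scaledCoframe]
    ring
  have hE : ∀ a b, S.gΘ t ν (p, r) (E a) (E b) = if a = b then 1 else 0 := by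
    intro a b
    rw [hg]
    simp [hθE, eq_comm]
  have hω : ∀ u v : W, wedge11 (θ 4) (θ 5) u v + wedge11 (θ 6) (θ 7) u v =
      S.s / 48 * ν r ^ 2 * S.omega 0 p u.1 v.1 := by
    intro u v
    refine Eq.trans ?_ (congrArg (S.s / 48 * ν r ^ 2 * ·) (f.omega_zero S u.1 v.1)).symm
    rw [← hρ2]
    change ρ * H 0 u.1 * (ρ * H 1 v.1) - ρ * H 0 v.1 * (ρ * H 1 u.1)
        + (ρ * H 2 u.1 * (ρ * H 3 v.1) - ρ * H 2 v.1 * (ρ * H 3 u.1)) =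
      ρ ^ 2 * (H 0 u.1 * H 1 v.1 - H 0 v.1 * H 1 u.1
        + (H 2 u.1 * H 3 v.1 - H 2 v.1 * H 3 u.1))
    ring
  have hΘ : ∀ u v : W, S.Θ t ν (p, r) (E 0) (E 1) u v =
      wedge11 (θ 2) (θ 3) u v - wedge11 (θ 4) (θ 5) u v - wedge11 (θ 6) (θ 7) u v := by
    intro u v
    let D : W → ℝ := fun w => dr (p, r) w
    let N : Fin 3 → W → ℝ := fun i => S.ηR i (p, r)
    let O : Fin 3 → W → W → ℝ := fun i => S.ωR i (p, r)
    have hN : ∀ i (w : W), N i w = A i w.1 := fun i w => S.ηR_apply i (p, r) w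
    have hO : ∀ i (v w : W), O i v w = S.omega i p v.1 w.1 := fun i v w =>
      S.ωR_apply i (p, r) v w
    have hD0 : D (E 0) = 1 := dr_apply (p, r) (E 0)
    have hD1 : D (E 1) = 0 := dr_apply (p, r) (E 1)
    have hN0 : ∀ i, N i (E 0) = 0 := fun i => (hN i _).trans (A i).map_zero
    have hN1 : ∀ i, N i (E 1) = (t r)⁻¹ * if i = 0 then 1 else 0 := fun i =>
      ((hN i _).trans ((A i).map_smul (t r)⁻¹ (f.vert 0))).trans
        (congrArg ((t r)⁻¹ * ·) ((congrArg (imComp i) (f.eta_vert 0)).trans (imComp_imUnit i 0)))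
    have hO0 : ∀ i w, O i (E 0) w = 0 := fun i w =>
      (hO i _ w).trans (f.omega_eq_zero S i (fun a => (H a).map_zero) w.1)
    have hO1 : ∀ i w, O i (E 1) w = 0 := fun i w =>
      (hO i _ w).trans (f.omega_eq_zero S i (fun a => ((H a).map_smul (t r)⁻¹ (f.vert 0)).trans
        (mul_eq_zero_of_right _ ((S.h_symm p _ _).trans (f.h_vert 0 _)))) w.1)
    have hO' : wedge11 (θ 4) (θ 5) u v + wedge11 (θ 6) (θ 7) u v =
        S.s / 48 * ν r ^ 2 * O 0 u v := by
      rw [hO, hω]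
    have hN' : wedge11 (θ 2) (θ 3) u v = t r ^ 2 * wedge11 (N 1) (N 2) u v := by
      simp only [wedge11, hN]
      change t r * A 1 u.1 * (t r * A 2 v.1) - t r * A 1 v.1 * (t r * A 2 u.1) = _
      ring
    rw [sub_sub, hO', hN']
    change wedge13 D (fun a b c => t r ^ 3 * wedge12 (N 0) (wedge11 (N 1) (N 2)) a b c
        - S.s / 48 * t r * ν r ^ 2 * ∑ i, wedge12 (N i) (O i) a b c) (E 0) (E 1) u v
      + (ν r ^ 4 / 6 * (S.s / 48) ^ 2 * ∑ i, wedge22 (O i) (O i) (E 0) (E 1) u v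
        - S.s / 48 * ν r ^ 2 * t r ^ 2 *
          ∑ i, wedge22 (wedge11 (N (i + 1)) (N (i + 2))) (O i) (E 0) (E 1) u v) = _
    clear_value D N O
    simp only [wedge13, wedge12, wedge22, wedge11, hD0, hD1, hN0, hN1, hO0, hO1,
      Fin.sum_univ_three]
    simp
    field_simp
  have hF : ∀ u v : W, imComp 0 (OneForm.curvature IC (S.radialForm x) (p, r) u v) =
      (x' / t r) * wedge11 (θ 0) (θ 1) u v +
      (2 * (x r ^ 2 - x r) / t r ^ 2) * wedge11 (θ 2) (θ 3) u v +
      (-(2 * x r / ν r ^ 2)) * (wedge11 (θ 4) (θ 5) u v + wedge11 (θ 6) (θ 7) u v) := by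
    intro u v
    refine (congrArg (imComp 0) (S.curvature_radialForm (p, r) hx u v)).trans ?_
    have homega : imComp 0 (OneForm.curvature (𝓡 7) S.η p u.1 v.1) =
        -(S.s / 24) * S.omega 0 p u.1 v.1 := by
      rw [omega]
      field_simp
    rw [imComp_add, imComp_add, imComp_smul, imComp_smul, imComp_smul, imComp_sub, imComp_smul,
      imComp_smul, imComp_zero_commutator, hω]
    refine (congrArg (fun z => _ + x r * z + _) homega).trans ?_
    change x' * (u.2 * A 0 v.1 - v.2 * A 0 u.1) + x r * _
        + (x r ^ 2 - x r) * (2 * (A 1 u.1 * A 2 v.1 - A 1 v.1 * A 2 u.1)) =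
      x' / t r * (u.2 * (t r * A 0 v.1) - v.2 * (t r * A 0 u.1))
        + 2 * (x r ^ 2 - x r) / t r ^ 2 * (t r * A 1 u.1 * (t r * A 2 v.1)
          - t r * A 1 v.1 * (t r * A 2 u.1)) + _
    field_simp
    ring
  have hmain := congrArg (imComp 0) (hinst (p, r) hr E hE (E 0) (E 1))
  rw [imComp_neg, imComp_smul, imComp_sum, hF] at hmain
  have hsum : ∀ a, imComp 0 (∑ b, S.Θ t ν (p, r) (E 0) (E 1) (E a) (E b) •
      OneForm.curvature IC (S.radialForm x) (p, r) (E a) (E b)) = _ := fun a =>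
    (imComp_sum _ _ _).trans (Finset.sum_congr rfl fun b _ =>
      (imComp_smul _ _ _).trans (congrArg₂ (· * ·) (hΘ (E a) (E b)) (hF (E a) (E b))))
  rw [Finset.sum_congr rfl fun a _ => hsum a] at hmain
  rw [sum_wedge11_dual θ E hθE] at hmain
  simp [wedge11, hθE, Fin.ext_iff] at hmain
  field_simp at hmain ⊢
  linarith

end ThreeSasakian

/-! ### The polar decomposition -/

namespace ThreeSasakian

theorem coe_unitPart {v : ℍ[ℝ]} (hv : v ≠ 0) : (unitPart v : ℍ[ℝ]) = ‖v‖⁻¹ • v := by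
  rw [unitPart, dif_neg hv]

theorem contMDiffAt_unitPart {v : ℍ[ℝ]} (hv : v ≠ 0) :
    ContMDiffAt 𝓘(ℝ, ℍ[ℝ]) (𝓡 3) ∞ unitPart v := by
  have hv' : 0 < ‖v‖ := norm_pos_iff.2 hv
  -- `g` maps `ℍ` smoothly to `ℍ ∖ 0` and agrees with the identity near `v`
  let b : ContDiffBump v := ⟨‖v‖ / 4, ‖v‖ / 2, by positivity, by linarith⟩
  let g : ℍ[ℝ] → ℍ[ℝ] := fun w => v + b w • (w - v)
  have hg : ContDiff ℝ ∞ g := contDiff_const.add (b.contDiff.smul (contDiff_id.sub contDiff_const))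
  have hg0 : ∀ w, g w ≠ 0 := by
    intro w hw
    have h1 : ‖b w • (w - v)‖ ≤ ‖v‖ / 2 := by
      by_cases hwv : dist w v < ‖v‖ / 2
      · rw [norm_smul, Real.norm_of_nonneg b.nonneg, ← dist_eq_norm]
        exact (mul_le_of_le_one_left dist_nonneg b.le_one).trans hwv.le
      · rw [b.zero_of_le_dist (not_lt.1 hwv), zero_smul, norm_zero]
        positivity
    have h2 : b w • (w - v) = -v := eq_neg_of_add_eq_zero_right hw
    rw [h2, norm_neg] at h1
    linarith
  have hsphere : ∀ w, ‖g w‖⁻¹ • g w ∈ Metric.sphere (0 : ℍ[ℝ]) 1 := by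
    intro w
    rw [mem_sphere_zero_iff_norm, norm_smul, norm_inv, norm_norm,
      inv_mul_cancel₀ (norm_ne_zero_iff.2 (hg0 w))]
  have hsmooth : ContDiff ℝ ∞ fun w => ‖g w‖⁻¹ • g w :=
    ((hg.norm ℝ hg0).inv fun w => norm_ne_zero_iff.2 (hg0 w)).smul hg
  refine (hsmooth.contMDiff.codRestrict_sphere hsphere v).congr_of_eventuallyEq ?_
  filter_upwards [b.eventuallyEq_one, isOpen_ne.mem_nhds hv] with w hw hw0
  have hgw : g w = w := by simp [g, hw]
  exact Subtype.ext (by rw [coe_unitPart hw0, codRestrict, Subtype.coe_mk, hgw])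

variable {X : Type*} [TopologicalSpace X] [ChartedSpace (EuclideanSpace ℝ (Fin 7)) X]
  (S : ThreeSasakian X)

theorem contMDiffAt_polar {a : X × ℍ[ℝ]} (ha : a.2 ≠ 0) : ContMDiffAt IP IC ∞ S.polar a := by
  have h1 : ContMDiffAt IP (𝓡 3) ∞ (fun a : X × ℍ[ℝ] => unitPart a.2) a :=
    (contMDiffAt_unitPart ha).comp a contMDiffAt_snd
  have h2 : ContMDiffAt IP 𝓘(ℝ, ℝ) ∞ (fun a : X × ℍ[ℝ] => ‖a.2‖) a :=
    (contDiffAt_norm ℝ ha).contMDiffAt.comp a contMDiffAt_snd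
  exact (S.act_smooth.contMDiffAt.comp a (contMDiffAt_fst.prodMk h1)).prodMk h2

theorem mdifferentiableAt_polar {a : X × ℍ[ℝ]} (ha : a.2 ≠ 0) :
    MDifferentiableAt IP IC S.polar a :=
  (S.contMDiffAt_polar ha).mdifferentiableAt (by simp)

/-! ### Lengths of curves and radial geodesics -/

theorem norm_snd_eq_of_proj_eq {a b : X × ℍ[ℝ]} (h : S.proj a = S.proj b) : ‖a.2‖ = ‖b.2‖ := by
  refine congrArg (Quot.lift (fun a : X × ℍ[ℝ] => ‖a.2‖) ?_) h
  rintro a _ ⟨g, rfl⟩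
  have hg : ‖(g : ℍ[ℝ])‖ = 1 := mem_sphere_zero_iff_norm.1 g.2
  simp [hg]

theorem sq_dr_le_gΘ (t ν : ℝ → ℝ) (q : X × ℝ) (w : EuclideanSpace ℝ (Fin 7) × ℝ) :
    w.2 ^ 2 ≤ S.gΘ t ν q w w := by
  rw [gΘ_apply]
  have h1 : 0 ≤ t q.2 ^ 2 * ∑ i, imComp i (S.η q.1 w.1) * imComp i (S.η q.1 w.1) :=
    mul_nonneg (sq_nonneg _) (Finset.sum_nonneg fun i _ => mul_self_nonneg _)
  have h2 : 0 ≤ S.s / 48 * ν q.2 ^ 2 * S.h q.1 w.1 w.1 :=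
    mul_nonneg (mul_nonneg (div_nonneg S.s_pos.le (by norm_num)) (sq_nonneg _))
      (S.h_self_nonneg q.1 w.1)
  nlinarith

theorem mfderiv_polar_velocity {γ : ℝ → X × ℍ[ℝ]} {τ : ℝ}
    (hγ : MDifferentiableAt 𝓘(ℝ, ℝ) IP γ τ) (h0 : (γ τ).2 ≠ 0) :
    mfderiv IP IC S.polar (γ τ) (velocity γ τ) =
      mfderiv 𝓘(ℝ, ℝ) IC (S.polar ∘ γ) τ (1 : ℝ) :=
  (mfderiv_comp_apply τ (S.mdifferentiableAt_polar h0) hγ (1 : ℝ)).symm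

/-- Away from the zero section the metric dominates `dr²`, so that the speed of a curve bounds the
derivative of its radial coordinate. -/
theorem sq_deriv_norm_le_gE (t ν : ℝ → ℝ) {γ : ℝ → X × ℍ[ℝ]} {τ : ℝ}
    (hγ : MDifferentiableAt 𝓘(ℝ, ℝ) IP γ τ) (h0 : (γ τ).2 ≠ 0) :
    deriv (fun τ => ‖(γ τ).2‖) τ ^ 2 ≤ S.gE t ν (γ τ) (velocity γ τ) (velocity γ τ) := by
  rw [gE, if_neg h0, S.mfderiv_polar_velocity hγ h0]
  have h1 : MDifferentiableAt 𝓘(ℝ, ℝ) IC (S.polar ∘ γ) τ := (S.mdifferentiableAt_polar h0).comp τ hγ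
  have h2 := mfderiv_comp_apply τ (g := (Prod.snd : X × ℝ → ℝ)) (I'' := 𝓘(ℝ, ℝ))
    mdifferentiableAt_snd h1 (1 : ℝ)
  rw [mfderiv_snd, mfderiv_eq_fderiv] at h2
  have h3 : deriv (fun τ => ‖(γ τ).2‖) τ =
      (mfderiv 𝓘(ℝ, ℝ) IC (S.polar ∘ γ) τ (1 : ℝ) : EuclideanSpace ℝ (Fin 7) × ℝ).2 := h2
  rw [h3]
  exact S.sq_dr_le_gΘ t ν _ _

theorem contDiff_snd_of_contMDiff {γ : ℝ → X × ℍ[ℝ]} (hγ : ContMDiff 𝓘(ℝ, ℝ) IP 1 γ) :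
    ContDiff ℝ 1 fun τ => (γ τ).2 :=
  (contMDiff_snd.comp hγ).contDiff

/-- The length of a curve is at least the increase of its radial coordinate. As the latter is not
differentiable on the zero section, it is approximated by `√(r² + ε²)`. -/
theorem ofReal_norm_sub_norm_le_curveLength (t ν : ℝ → ℝ) {γ : ℝ → X × ℍ[ℝ]}
    (hγ : ContMDiff 𝓘(ℝ, ℝ) IP 1 γ) :
    ENNReal.ofReal (‖(γ 1).2‖ - ‖(γ 0).2‖) ≤ S.curveLength t ν γ := by
  set w : ℝ → ℍ[ℝ] := fun τ => (γ τ).2 with hw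
  have hwc : ContDiff ℝ 1 w := contDiff_snd_of_contMDiff hγ
  have hwd : ∀ τ, HasDerivAt w (deriv w τ) τ := fun τ =>
    (hwc.differentiable one_ne_zero τ).hasDerivAt
  have hε : ∀ ε : ℝ, 0 < ε →
      ENNReal.ofReal (√(‖w 1‖ ^ 2 + ε ^ 2) - √(‖w 0‖ ^ 2 + ε ^ 2)) ≤ S.curveLength t ν γ := by
    intro ε hε
    have hpos : ∀ τ, 0 < ‖w τ‖ ^ 2 + ε ^ 2 := fun τ => by positivity
    have hρ : ContDiff ℝ 1 fun τ => √(‖w τ‖ ^ 2 + ε ^ 2) :=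
      ((hwc.norm_sq ℝ).add contDiff_const).sqrt fun τ => (hpos τ).ne'
    have hρd : ∀ τ, deriv (fun τ => √(‖w τ‖ ^ 2 + ε ^ 2)) τ =
        inner ℝ (w τ) (deriv w τ) / √(‖w τ‖ ^ 2 + ε ^ 2) := by
      intro τ
      rw [(((hwd τ).norm_sq.add_const (ε ^ 2)).sqrt (hpos τ).ne').deriv]
      rw [mul_div_mul_left _ _ two_ne_zero]
    refine (ENNReal.ofReal_le_ofReal (le_abs_self _)).trans ?_
    rw [← Real.enorm_eq_ofReal_abs]
    refine (enorm_sub_le_lintegral_deriv_of_contDiffOn_Icc hρ.contDiffOn zero_le_one).trans ?_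
    refine lintegral_mono fun τ => ?_
    rw [Real.enorm_eq_ofReal_abs]
    refine ENNReal.ofReal_le_ofReal ?_
    by_cases h0 : w τ = 0
    · rw [hρd, h0, inner_zero_left, zero_div, abs_zero]
      exact Real.sqrt_nonneg _
    · have hn : 0 < ‖w τ‖ := norm_pos_iff.2 h0
      refine le_trans ?_ (Real.abs_le_sqrt (S.sq_deriv_norm_le_gE t ν
        ((hγ τ).mdifferentiableAt one_ne_zero) h0))
      have hnorm : deriv (fun τ => ‖w τ‖) τ = inner ℝ (w τ) (deriv w τ) / ‖w τ‖ := by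
        have h1 := ((hwd τ).norm_sq.sqrt (by positivity)).deriv
        simp only [Real.sqrt_sq (norm_nonneg _)] at h1
        rw [h1, mul_div_mul_left _ _ two_ne_zero]
      rw [hρd, hnorm, abs_div, abs_div, abs_of_pos hn, abs_of_pos (Real.sqrt_pos.2 (hpos τ))]
      refine div_le_div_of_nonneg_left (abs_nonneg _) hn ?_
      exact Real.le_sqrt_of_sq_le (by nlinarith [sq_nonneg ε])
  have hlim : Tendsto (fun ε : ℝ =>
      ENNReal.ofReal (√(‖w 1‖ ^ 2 + ε ^ 2) - √(‖w 0‖ ^ 2 + ε ^ 2))) (𝓝[>] 0)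
      (𝓝 (ENNReal.ofReal (‖w 1‖ - ‖w 0‖))) := by
    have hc : Continuous fun ε : ℝ =>
        ENNReal.ofReal (√(‖w 1‖ ^ 2 + ε ^ 2) - √(‖w 0‖ ^ 2 + ε ^ 2)) :=
      ENNReal.continuous_ofReal.comp (by fun_prop)
    have h1 := (hc.tendsto 0).mono_left (nhdsWithin_le_nhds (s := Ioi 0))
    simpa [Real.sqrt_sq (norm_nonneg _)] using h1
  exact le_of_tendsto hlim (eventually_of_mem self_mem_nhdsWithin hε)

theorem contMDiff_fibreLine (p : X) (u : ℍ[ℝ]) :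
    ContMDiff 𝓘(ℝ, ℝ) IP ∞ fun τ : ℝ => ((p, τ • u) : X × ℍ[ℝ]) :=
  contMDiff_const.prodMk (ContDiff.contMDiff (by fun_prop))

theorem velocity_fibreLine (p : X) (u : ℍ[ℝ]) (τ : ℝ) :
    velocity (fun τ : ℝ => ((p, τ • u) : X × ℍ[ℝ])) τ =
      ((0, u) : EuclideanSpace ℝ (Fin 7) × ℍ[ℝ]) := by
  have h1 : MDifferentiableAt 𝓘(ℝ, ℝ) 𝓘(ℝ, ℍ[ℝ]) (fun τ : ℝ => τ • u) τ :=
    DifferentiableAt.mdifferentiableAt (by fun_prop)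
  have h2 : fderiv ℝ (fun τ : ℝ => τ • u) τ 1 = u := by
    rw [fderiv_apply_one_eq_deriv, ((hasDerivAt_id' τ).smul_const u).deriv, one_smul]
  rw [velocity, mfderiv_prodMk mdifferentiableAt_const h1, mfderiv_const, mfderiv_eq_fderiv]
  exact Prod.ext rfl h2

theorem gE_velocity_fibreLine (t ν : ℝ → ℝ) (p : X) (u : ℍ[ℝ]) {τ : ℝ} (hτ : 0 ≤ τ) :
    S.gE t ν (p, τ • u) (velocity (fun τ : ℝ => ((p, τ • u) : X × ℍ[ℝ])) τ)
      (velocity (fun τ : ℝ => ((p, τ • u) : X × ℍ[ℝ])) τ) = ‖u‖ ^ 2 := by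
  by_cases h0 : τ • u = 0
  · rw [gE, if_pos h0, velocity_fibreLine, mvfderiv, mfderiv_snd, mfderiv_fst]
    change inner ℝ u u + S.s / 48 * ν 0 ^ 2 * S.h p (0 : TangentSpace (𝓡 7) p) 0 = _
    rw [map_zero, mul_zero, add_zero, real_inner_self_eq_norm_sq]
  · have hτ0 : 0 < τ := hτ.lt_of_ne fun h => h0 (by rw [← h, zero_smul])
    have hu : u ≠ 0 := fun h => h0 (by rw [h, smul_zero])
    have hγ := (contMDiff_fibreLine p u τ).mdifferentiableAt (by simp)
    have h1 := S.mfderiv_polar_velocity hγ h0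
    have heq : S.polar ∘ (fun τ : ℝ => ((p, τ • u) : X × ℍ[ℝ])) =ᶠ[𝓝 τ]
        fun τ => (S.act p (unitPart u), τ * ‖u‖) := by
      filter_upwards [Ioi_mem_nhds hτ0] with σ hσ
      have hσ : 0 < σ := hσ
      have hunit : unitPart (σ • u) = unitPart u := by
        refine Subtype.ext ?_
        rw [coe_unitPart (smul_ne_zero hσ.ne' hu), coe_unitPart hu, norm_smul,
          Real.norm_of_nonneg hσ.le, smul_smul]
        congr 1
        field_simp
      simp only [Function.comp_apply, polar, hunit, norm_smul, Real.norm_of_nonneg hσ.le]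
    have h2 : MDifferentiableAt 𝓘(ℝ, ℝ) 𝓘(ℝ, ℝ) (fun τ : ℝ => τ * ‖u‖) τ :=
      DifferentiableAt.mdifferentiableAt (by fun_prop)
    have h3 : fderiv ℝ (fun τ : ℝ => τ * ‖u‖) τ 1 = ‖u‖ := by
      rw [fderiv_apply_one_eq_deriv, ((hasDerivAt_id' τ).mul_const ‖u‖).deriv, one_mul]
    have h4 : mfderiv 𝓘(ℝ, ℝ) IC
        (S.polar ∘ (fun τ : ℝ => ((p, τ • u) : X × ℍ[ℝ]))) τ (1 : ℝ) =
          ((0, ‖u‖) : EuclideanSpace ℝ (Fin 7) × ℝ) := by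
      rw [heq.mfderiv_eq, mfderiv_prodMk mdifferentiableAt_const h2, mfderiv_const,
        mfderiv_eq_fderiv]
      exact Prod.ext rfl h3
    rw [gE, if_neg h0, h1, h4, gΘ_apply]
    have h5 : ∀ (q : X), S.η q (0 : EuclideanSpace ℝ (Fin 7)) = 0 := fun q => map_zero (S.η q)
    have h6 : ∀ (q : X), S.h q (0 : EuclideanSpace ℝ (Fin 7)) (0 : EuclideanSpace ℝ (Fin 7)) = 0 :=
      fun q => map_zero _
    have h7 : ∀ i, imComp i 0 = 0 := fun i => (imCompₗ i).map_zero
    simp only [h5, h6, h7]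
    simp [sq]

/-- The straight ray `τ ↦ [(p, τ u)]` in the fibre is a minimizing geodesic. -/
theorem isGeodesicLift_fibreLine (t ν : ℝ → ℝ) (p : X) (u : ℍ[ℝ]) :
    S.IsGeodesicLift t ν fun τ : ℝ => ((p, τ • u) : X × ℍ[ℝ]) where
  smooth := contMDiff_fibreLine p u
  minimizing := by
    refine ⟨‖u‖, norm_nonneg u, fun τ hτ => S.gE_velocity_fibreLine t ν p u hτ.1,
      fun τ₀ _ => ⟨1, one_pos, fun τ₁ h₁ τ₂ h₂ _ _ _ γ hγ hγ0 hγ1 => ?_⟩⟩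
    have h0 := S.norm_snd_eq_of_proj_eq hγ0
    have h1 := S.norm_snd_eq_of_proj_eq hγ1
    simp only [norm_smul, Real.norm_of_nonneg h₁.1, Real.norm_of_nonneg h₂.1] at h0 h1
    rw [sub_mul, ← h0, ← h1]
    exact S.ofReal_norm_sub_norm_le_curveLength t ν hγ

/-- In the trivialization of the fibre over `z`, the exponential map of the normal space is the
identity. -/
theorem isScaledExp_fibreMap (t ν : ℝ → ℝ) (p : X) (lam : ℝ) :
    S.IsScaledExp t ν p lam (fibreMap p lam) := by
  intro v
  refine ⟨_, S.isGeodesicLift_fibreLine t ν p (lam • v), by simp, ?_, by simp [fibreMap]⟩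
  rw [velocity_fibreLine, normalVector, mfderiv_prod_right]
  rfl

end ThreeSasakian

namespace ThreeSasakian

variable {X : Type*} [TopologicalSpace X] [ChartedSpace (EuclideanSpace ℝ (Fin 7)) X]
  (S : ThreeSasakian X)

/-! ### The radial functions of the instantons -/

section RadialFunction

variable [IsManifold (𝓡 7) ∞ X] {S} {ν₀ : ℝ} {t ν x : ℝ → ℝ}

theorem IsRadialInstanton.hasDerivAt (hx : S.IsRadialInstanton t ν x) (h : IsProfile ν₀ t ν)
    (p : X) {r : ℝ} (hr : 0 < r) :
    HasDerivAt x (2 * x r * (1 - x r) / t r - 4 * x r * t r / ν r ^ 2) r := by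
  have h1 : HasDerivAt x (deriv x r) r :=
    ((hx.smooth.differentiableOn (by simp)).differentiableAt (Ioi_mem_nhds hr)).hasDerivAt
  rwa [S.radial_equation hx.instanton p hr (h.t_pos hr) (h.nu_pos r hr.le) h1] at h1

theorem IsRadialInstanton.eq_of_tendsto_div_sq (hx : S.IsRadialInstanton t ν x)
    (h : IsProfile ν₀ t ν) (p : X) {y₀ : ℝ} (hy₀ : 0 < y₀)
    (hlim : Tendsto (fun r => x r / r ^ 2) (𝓝[>] 0) (𝓝 y₀)) {r : ℝ} (hr : 0 < r) :
    x r * (y₀⁻¹ + (ν r ^ 2 - ν₀ ^ 2) / 3) = t r ^ 2 := by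
  refine h.radial_solution (fun r hr => hx.hasDerivAt h p hr) ?_ ?_ hr
  · filter_upwards [hlim.eventually_ne hy₀.ne'] with r hr hxr
    simp [hxr] at hr
  · obtain ⟨τ, _, hτ, _, htτ, _, hτ0, _⟩ := h.exists_smooth_quotients ℝ
    have h1 : Tendsto (fun r => τ r ^ 2 / (x r / r ^ 2)) (𝓝[>] 0) (𝓝 (1 ^ 2 / y₀)) := by
      have h2 := (hτ.continuous.tendsto 0).mono_left (nhdsWithin_le_nhds (s := Ioi 0))
      rw [hτ0] at h2
      exact (h2.pow 2).div hlim hy₀.ne'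
    rw [one_pow, one_div] at h1
    refine h1.congr' ?_
    filter_upwards [self_mem_nhdsWithin] with r hr
    have hr : 0 < r := hr
    have h3 := htτ r
    rw [Real.norm_of_nonneg hr.le] at h3
    rw [h3]
    field_simp

theorem IsRadialInstanton.eq_of_tendsto_one (hx : S.IsRadialInstanton t ν x)
    (h : IsProfile ν₀ t ν) (p : X) (hlim : Tendsto x (𝓝[>] 0) (𝓝 1)) {r : ℝ} (hr : 0 < r) :
    x r * (0 + (ν r ^ 2 - ν₀ ^ 2) / 3) = t r ^ 2 := by
  refine h.radial_solution (fun r hr => hx.hasDerivAt h p hr) (hlim.eventually_ne one_ne_zero)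
    ?_ hr
  have h1 : Tendsto t (𝓝[>] 0) (𝓝 0) := by
    have h2 := (h.continuousOn_t 0 (mem_Ici.2 le_rfl)).tendsto.mono_left
      (nhdsWithin_mono 0 Ioi_subset_Ici_self)
    rwa [h.t_zero] at h2
  have h2 : Tendsto (fun r => t r ^ 2 / x r) (𝓝[>] 0) (𝓝 (0 ^ 2 / 1)) :=
    (h1.pow 2).div hlim one_ne_zero
  simpa using h2

end RadialFunction

/-! ### Restriction to a fibre -/

theorem contMDiff_fibreMap (p : X) (lam : ℝ) :
    ContMDiff 𝓘(ℝ, ℍ[ℝ]) IP ∞ (fibreMap p lam) :=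
  contMDiff_const.prodMk (ContDiff.contMDiff (by fun_prop))

/-- On a fibre, `η` pulls back under the polar decomposition to the left-invariant form of
`SU(2)`. -/
theorem eta_mfderiv_act_unitPart (p : X) {v : ℍ[ℝ]} (hv : v ≠ 0) (w : ℍ[ℝ]) :
    S.η (S.act p (unitPart v))
      (mfderiv (𝓡 3) (𝓡 7) (S.act p) (unitPart v)
        (mfderiv 𝓘(ℝ, ℍ[ℝ]) (𝓡 3) unitPart v w)) = leftInvariantForm v w := by
  have hunit : MDifferentiableAt 𝓘(ℝ, ℍ[ℝ]) (𝓡 3) unitPart v :=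
    (contMDiffAt_unitPart hv).mdifferentiableAt (by simp)
  have hcoe : MDifferentiableAt (𝓡 3) 𝓘(ℝ, ℍ[ℝ]) (fun g : SU2 => (g : ℍ[ℝ])) (unitPart v) :=
    (contMDiff_coe_sphere (n := 3) (m := ∞) (unitPart v)).mdifferentiableAt (by simp)
  set ξ := mfderiv 𝓘(ℝ, ℍ[ℝ]) (𝓡 3) unitPart v w with hξ
  have h1 := mfderiv_comp_apply v hcoe hunit w
  have heq : ((fun g : SU2 => (g : ℍ[ℝ])) ∘ unitPart) =ᶠ[𝓝 v] fun u => ‖u‖⁻¹ • u := by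
    filter_upwards [isOpen_ne.mem_nhds hv] with u hu using coe_unitPart hu
  have hd : DifferentiableAt ℝ (fun u : ℍ[ℝ] => ‖u‖⁻¹) v :=
    ((contDiffAt_norm ℝ hv (n := 1)).differentiableAt one_ne_zero).inv (norm_ne_zero_iff.2 hv)
  have hfd : HasFDerivAt (fun u : ℍ[ℝ] => ‖u‖⁻¹ • u) _ v := hd.hasFDerivAt.smul (hasFDerivAt_id v)
  rw [heq.mfderiv_eq, mfderiv_eq_fderiv, hfd.fderiv] at h1
  have h2 : mvfderiv (𝓡 3) (fun g : SU2 => (g : ℍ[ℝ])) (unitPart v) ξ =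
      ‖v‖⁻¹ • w + (fderiv ℝ (fun u : ℍ[ℝ] => ‖u‖⁻¹) v w) • v := h1.symm
  have h3 := S.eta_orbit p (unitPart v) ξ
  have him := S.eta_im _ (mfderiv (𝓡 3) (𝓡 7) (S.act p) (unitPart v) ξ)
  -- `η` is imaginary, and the radial derivative of `v / |v|` contributes only to the real part
  rw [h3, h2, coe_unitPart hv] at him
  rw [h3, h2, coe_unitPart hv]
  set c := fderiv ℝ (fun u : ℍ[ℝ] => ‖u‖⁻¹) v w
  change _ = (‖v‖ ^ 2)⁻¹ • (star v * w).im
  have h4 : ∀ z : ℍ[ℝ], z.re = 0 → z = z.im := fun z hz => by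
    ext <;> simp [hz]
  rw [h4 _ him]
  ext <;> simp <;> ring

theorem pullback_fibreMap_apply {x : ℝ → ℝ} {A : OneForm IP (X × ℍ[ℝ]) ℍ[ℝ]}
    (hA : ∀ a : X × ℍ[ℝ], a.2 ≠ 0 →
      A a = OneForm.pullback IC IP S.polar (S.radialForm x) a) (p : X) {lam : ℝ} (hlam : 0 < lam)
    {v : ℍ[ℝ]} (hv : v ≠ 0) :
    OneForm.pullback IP 𝓘(ℝ, ℍ[ℝ]) (fibreMap p lam) A v =
      x (lam * ‖v‖) • leftInvariantForm v := by
  refine ContinuousLinearMap.ext fun w => ?_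
  have hv' : (fibreMap p lam v).2 ≠ 0 := smul_ne_zero hlam.ne' hv
  have hunit : ∀ u : ℍ[ℝ], u ≠ 0 → unitPart (lam • u) = unitPart u := by
    intro u hu
    refine Subtype.ext ?_
    rw [coe_unitPart (smul_ne_zero hlam.ne' hu), coe_unitPart hu, norm_smul,
      Real.norm_of_nonneg hlam.le, smul_smul]
    congr 1
    field_simp
  have hf : MDifferentiableAt 𝓘(ℝ, ℍ[ℝ]) IP (fibreMap p lam) v :=
    (contMDiff_fibreMap p lam v).mdifferentiableAt (by simp)
  have hpol := S.mdifferentiableAt_polar hv'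
  have h1 := mfderiv_comp_apply v hpol hf w
  have hpf : MDifferentiableAt 𝓘(ℝ, ℍ[ℝ]) IC (S.polar ∘ fibreMap p lam) v := hpol.comp v hf
  have h2 := mfderiv_comp_apply v (g := (Prod.fst : X × ℝ → X)) mdifferentiableAt_fst hpf w
  have heq : (Prod.fst : X × ℝ → X) ∘ (S.polar ∘ fibreMap p lam) =ᶠ[𝓝 v]
      S.act p ∘ unitPart := by
    filter_upwards [isOpen_ne.mem_nhds hv] with u hu
    exact congrArg (S.act p) (hunit u hu)
  have hact : MDifferentiableAt (𝓡 3) (𝓡 7) (S.act p) (unitPart v) :=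
    ((S.act_smooth.comp (contMDiff_const.prodMk contMDiff_id)) (unitPart v)).mdifferentiableAt
      (by simp)
  have h3 := mfderiv_comp_apply v hact
    ((contMDiffAt_unitPart hv).mdifferentiableAt (by simp)) w
  -- The tangent spaces at `p'` and `p''` are both the model space, so `U` needs no transport.
  have h4 : ∀ (p' p'' : X) (U : EuclideanSpace ℝ (Fin 7)), p' = p'' → S.η p' U = S.η p'' U := by
    rintro _ _ _ rfl
    rfl
  have hpolar : S.polar (fibreMap p lam v) = (S.act p (unitPart v), lam * ‖v‖) := by
    simp only [polar, fibreMap, hunit v hv, norm_smul, Real.norm_of_nonneg hlam.le]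
  calc OneForm.pullback IP 𝓘(ℝ, ℍ[ℝ]) (fibreMap p lam) A v w
      = OneForm.pullback IC IP S.polar (S.radialForm x) (fibreMap p lam v)
          (mfderiv 𝓘(ℝ, ℍ[ℝ]) IP (fibreMap p lam) v w) :=
        congrArg (fun L : EuclideanSpace ℝ (Fin 7) × ℍ[ℝ] →L[ℝ] ℍ[ℝ] =>
          L (mfderiv 𝓘(ℝ, ℍ[ℝ]) IP (fibreMap p lam) v w)) (hA (fibreMap p lam v) hv')
    _ = x (S.polar (fibreMap p lam v)).2 • S.η (S.polar (fibreMap p lam v)).1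
          (dX (S.polar (fibreMap p lam v)) (mfderiv IP IC S.polar (fibreMap p lam v)
            (mfderiv 𝓘(ℝ, ℍ[ℝ]) IP (fibreMap p lam) v w))) := rfl
    _ = x (lam * ‖v‖) • S.η (S.polar (fibreMap p lam v)).1
          (mfderiv 𝓘(ℝ, ℍ[ℝ]) (𝓡 7) (S.act p ∘ unitPart) v w) := by
        rw [← heq.mfderiv_eq]
        refine congrArg₂ (fun (a : ℝ) (b : ℍ[ℝ]) => a • b) (by rw [hpolar]) (congrArg _ ?_)
        exact ((congrArg (dX (S.polar (fibreMap p lam v))) h1).symm.trans h2.symm)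
    _ = x (lam * ‖v‖) • leftInvariantForm v w := by
        rw [← S.eta_mfderiv_act_unitPart p hv w]
        exact congrArg (fun z : ℍ[ℝ] => x (lam * ‖v‖) • z)
          ((h4 _ _ _ (congrArg Prod.fst hpolar)).trans (congrArg _ h3))

theorem continuous_pullback_fibreMap [IsManifold (𝓡 7) ∞ X] {A : OneForm IP (X × ℍ[ℝ]) ℍ[ℝ]}
    (hA : OneForm.IsSmooth IP A) (p : X) (lam : ℝ) :
    Continuous (OneForm.coeff (OneForm.pullback IP 𝓘(ℝ, ℍ[ℝ]) (fibreMap p lam) A)) := by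
  set m : X × ℍ[ℝ] := (p, 0) with hm
  set y : ℍ[ℝ] → EuclideanSpace ℝ (Fin 7) × ℍ[ℝ] := fun v => (extChartAt (𝓡 7) p p, lam • v)
    with hy
  have hyc : Continuous y := by fun_prop
  have hmem : ∀ v, y v ∈ (extChartAt IP m).target := fun v =>
    mem_extChartAt_prod_target.2 (mem_extChartAt_target p)
  have hsymm : ∀ v, (extChartAt IP m).symm (y v) = fibreMap p lam v := fun v =>
    (extChartAt_prod_symm_apply m (y v)).trans (Prod.ext (extChartAt_to_inv p) rfl)
  have hyd : ∀ v, HasFDerivAt y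
      (lam • ContinuousLinearMap.inr ℝ (EuclideanSpace ℝ (Fin 7)) ℍ[ℝ]) v := by
    intro v
    have h0 : HasFDerivAt (fun v : ℍ[ℝ] => lam • v) (lam • ContinuousLinearMap.id ℝ ℍ[ℝ]) v :=
      (hasFDerivAt_id v).const_smul lam
    have h1 := (hasFDerivAt_const (extChartAt (𝓡 7) p p) v).prodMk h0
    convert! h1 using 1
    ext w <;> simp
  have heq : OneForm.coeff (OneForm.pullback IP 𝓘(ℝ, ℍ[ℝ]) (fibreMap p lam) A) = fun v =>
      (OneForm.inChart IP A m (y v)).comp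
        (lam • ContinuousLinearMap.inr ℝ (EuclideanSpace ℝ (Fin 7)) ℍ[ℝ]) := by
    funext v
    refine ContinuousLinearMap.ext fun w => ?_
    have h1 := mfderiv_comp_apply v (I := 𝓘(ℝ, ℍ[ℝ]))
      (I' := 𝓘(ℝ, EuclideanSpace ℝ (Fin 7) × ℍ[ℝ]))
      (mdifferentiableAt_extChartAt_prod_symm (hmem v))
      (hyd v).differentiableAt.mdifferentiableAt w
    rw [mfderiv_eq_fderiv, (hyd v).fderiv] at h1
    have h2 : (extChartAt IP m).symm ∘ y = fibreMap p lam := funext hsymm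
    have h3 : ∀ (a b : X × ℍ[ℝ]) (W : EuclideanSpace ℝ (Fin 7) × ℍ[ℝ]), a = b →
        A a W = A b W := by
      rintro _ _ _ rfl
      rfl
    rw [h2] at h1
    exact (congrArg (A (fibreMap p lam v)) h1).trans (h3 _ _ _ (hsymm v).symm)
  rw [heq]
  exact (((hA m).continuousOn.comp_continuous hyc hmem).clm_comp continuous_const)

/-! ### Restriction to the complement of the zero section -/

theorem contMDiff_fromPolar : ContMDiff IC IP ∞ (fromPolar : X × ℝ → X × ℍ[ℝ]) :=
  contMDiff_fst.prodMk
    (((Algebra.linearMap ℝ ℍ[ℝ]).toContinuousLinearMap.contDiff.contMDiff).comp contMDiff_snd)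

theorem polar_fromPolar {q : X × ℝ} (hq : 0 < q.2) : S.polar (fromPolar q) = q := by
  have hne : (q.2 : ℍ[ℝ]) ≠ 0 := fun h => hq.ne' (Quaternion.coe_injective h)
  have hnorm : ‖(q.2 : ℍ[ℝ])‖ = q.2 := by
    rw [Quaternion.norm_coe, Real.norm_of_nonneg hq.le]
  have hunit : unitPart (q.2 : ℍ[ℝ]) = 1 := by
    refine Subtype.ext ?_
    rw [coe_unitPart hne, hnorm, ← Quaternion.coe_smul, smul_eq_mul, inv_mul_cancel₀ hq.ne']
    rfl
  exact Prod.ext (by simp only [polar, fromPolar, hunit, S.act_one]) hnorm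

theorem pullback_fromPolar_apply {x : ℝ → ℝ} {A : OneForm IP (X × ℍ[ℝ]) ℍ[ℝ]}
    (hA : ∀ a : X × ℍ[ℝ], a.2 ≠ 0 →
      A a = OneForm.pullback IC IP S.polar (S.radialForm x) a) {q : X × ℝ} (hq : 0 < q.2) :
    OneForm.pullback IP IC fromPolar A q = S.radialForm x q := by
  refine ContinuousLinearMap.ext fun w => ?_
  have hne : (fromPolar q).2 ≠ 0 := fun h => hq.ne' (Quaternion.coe_injective h)
  have h1 := mfderiv_comp_apply q (S.mdifferentiableAt_polar hne)
    ((contMDiff_fromPolar q).mdifferentiableAt (by simp)) w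
  have heq : S.polar ∘ fromPolar =ᶠ[𝓝 q] id :=
    eventually_of_mem ((isOpen_Ioi.preimage continuous_snd).mem_nhds hq)
      fun q' hq' => S.polar_fromPolar hq'
  rw [heq.mfderiv_eq, mfderiv_id] at h1
  have h2 : ∀ (a b : X × ℝ) (W : EuclideanSpace ℝ (Fin 7) × ℝ), a = b →
      S.radialForm x a W = S.radialForm x b W := by
    rintro _ _ _ rfl
    rfl
  calc OneForm.pullback IP IC fromPolar A q w
      = OneForm.pullback IC IP S.polar (S.radialForm x) (fromPolar q)
          (mfderiv IC IP fromPolar q w) :=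
        congrArg (fun L : EuclideanSpace ℝ (Fin 7) × ℍ[ℝ] →L[ℝ] ℍ[ℝ] =>
          L (mfderiv IC IP fromPolar q w)) (hA (fromPolar q) hne)
    _ = S.radialForm x (S.polar (fromPolar q)) w :=
        congrArg (S.radialForm x (S.polar (fromPolar q))) h1.symm
    _ = S.radialForm x q w := h2 _ _ _ (S.polar_fromPolar hq)

end ThreeSasakian

/-! ### Bubbling along the zero section -/

theorem contDiff_smul_bilinear {E F G : Type*} [NormedAddCommGroup E] [NormedSpace ℝ E]
    [NormedAddCommGroup F] [NormedSpace ℝ F] [NormedAddCommGroup G] [NormedSpace ℝ G]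
    (L : E →L[ℝ] E →L[ℝ] F) {f : G → ℝ} {g : G → E} (hf : ContDiff ℝ ∞ f)
    (hg : ContDiff ℝ ∞ g) : ContDiff ℝ ∞ fun z => f z • L (g z) :=
  hf.smul (L.contDiff.comp hg)

/-- The bilinear map `(v, w) ↦ Im (v̄ w)` on the quaternions. -/
noncomputable def imStarMul : ℍ[ℝ] →L[ℝ] ℍ[ℝ] →L[ℝ] ℍ[ℝ] :=
  LinearMap.toContinuousBilinearMap <| LinearMap.mk₂ ℝ (fun v w => (star v * w).im)
    (fun v v' w => by simp [add_mul]) (fun c v w => by simp)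
    (fun v w w' => by simp [mul_add]) (fun c v w => by simp)

theorem leftInvariantForm_apply (v w : ℍ[ℝ]) :
    leftInvariantForm v w = (‖v‖ ^ 2)⁻¹ • (star v * w).im := rfl

/-- The coefficients of the rescaled connection on a fibre, as a function of the scale `c` and of
the point `v`, in terms of `τ = t / r` and `q = (ν² - ν₀²) / (3 r²)`. At `c = 0` this is the basic
instanton. -/
noncomputable def rescaledFibreForm (τ q : ℍ[ℝ] → ℝ) (κ : ℝ) (z : ℝ × ℍ[ℝ]) :
    ℍ[ℝ] →L[ℝ] ℍ[ℝ] :=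
  (κ * τ (z.1 • z.2) ^ 2 / (1 + κ * (‖z.2‖ ^ 2 * q (z.1 • z.2)))) • imStarMul z.2

theorem rescaledFibreForm_apply (τ q : ℍ[ℝ] → ℝ) (κ c : ℝ) (v w : ℍ[ℝ]) :
    rescaledFibreForm τ q κ (c, v) w =
      (κ * τ (c • v) ^ 2 / (1 + κ * (‖v‖ ^ 2 * q (c • v)))) • (star v * w).im := rfl

theorem contDiff_rescaledFibreForm {τ q : ℍ[ℝ] → ℝ} (hτ : ContDiff ℝ ∞ τ) (hq : ContDiff ℝ ∞ q)
    (hq0 : ∀ v, 0 ≤ q v) {κ : ℝ} (hκ : 0 < κ) : ContDiff ℝ ∞ (rescaledFibreForm τ q κ) := by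
  have h1 : ContDiff ℝ ∞ fun z : ℝ × ℍ[ℝ] => z.1 • z.2 := contDiff_fst.smul contDiff_snd
  refine contDiff_smul_bilinear imStarMul (ContDiff.div (contDiff_const.mul ((hτ.comp h1).pow 2))
    (contDiff_const.add (contDiff_const.mul ((contDiff_snd.norm_sq ℝ).mul (hq.comp h1)))) ?_)
    contDiff_snd
  intro z
  have := mul_nonneg hκ.le (mul_nonneg (sq_nonneg ‖z.2‖) (hq0 (z.1 • z.2)))
  positivity

theorem rescaledFibreForm_zero {τ q : ℍ[ℝ] → ℝ} (hτ0 : τ 0 = 1) (hq0 : q 0 = 1) (κ : ℝ) :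
    (fun v => rescaledFibreForm τ q κ (0, v)) = (asdInstanton κ).coeff := by
  funext v
  refine ContinuousLinearMap.ext fun w => ?_
  change rescaledFibreForm τ q κ (0, v) w =
    (κ * ‖v‖ ^ 2 / (1 + κ * ‖v‖ ^ 2)) • leftInvariantForm v w
  rw [rescaledFibreForm_apply, leftInvariantForm_apply, zero_smul, hτ0, hq0]
  by_cases hv : v = 0
  · simp [hv]
  · have hv' : ‖v‖ ≠ 0 := norm_ne_zero_iff.2 hv
    rw [smul_smul]
    congr 1
    field_simp

namespace ThreeSasakian

variable {X : Type*} [TopologicalSpace X] [ChartedSpace (EuclideanSpace ℝ (Fin 7)) X]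
  [IsManifold (𝓡 7) ∞ X] {S : ThreeSasakian X} {ν₀ : ℝ} {t ν : ℝ → ℝ}

theorem IsInstantonWithParameter.coeff_pullback_fibreMap {y₀ : ℝ} (hy₀ : 0 < y₀)
    {A : OneForm IP (X × ℍ[ℝ]) ℍ[ℝ]} (hA : S.IsInstantonWithParameter t ν y₀ A)
    (h : IsProfile ν₀ t ν) {τ q : ℍ[ℝ] → ℝ} (hτ : ContDiff ℝ ∞ τ) (hq : ContDiff ℝ ∞ q)
    (htτ : ∀ v, t ‖v‖ = ‖v‖ * τ v) (hνq : ∀ v, ν ‖v‖ ^ 2 - ν₀ ^ 2 = 3 * (‖v‖ ^ 2 * q v))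
    (hq0 : ∀ v, 0 ≤ q v) {κ : ℝ} (hκ : 0 < κ) (p : X) :
    (OneForm.pullback IP 𝓘(ℝ, ℍ[ℝ]) (fibreMap p √(κ / y₀)) A).coeff =
      fun v => rescaledFibreForm τ q κ (√(κ / y₀), v) := by
  obtain ⟨x, hx, hAx, hlim⟩ := hA.radial
  have hlam : 0 < √(κ / y₀) := Real.sqrt_pos.2 (div_pos hκ hy₀)
  have hcont : Continuous fun v => rescaledFibreForm τ q κ (√(κ / y₀), v) :=
    (contDiff_rescaledFibreForm hτ hq hq0 hκ).continuous.comp (by fun_prop)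
  -- both sides are continuous, so that the equality need only be checked for `v ≠ 0`
  refine (continuous_pullback_fibreMap hA.smooth p _).ext_on (dense_compl_singleton (0 : ℍ[ℝ]))
    hcont fun v hv => ?_
  have hv : v ≠ 0 := hv
  have hv' : 0 < ‖v‖ := norm_pos_iff.2 hv
  refine (S.pullback_fibreMap_apply hAx p hlam hv).trans ?_
  have hnorm : ‖√(κ / y₀) • v‖ = √(κ / y₀) * ‖v‖ := by
    rw [norm_smul, Real.norm_of_nonneg hlam.le]
  have h1 := hx.eq_of_tendsto_div_sq h p hy₀ hlim (mul_pos hlam hv')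
  have h2 := htτ (√(κ / y₀) • v)
  have h3 := hνq (√(κ / y₀) • v)
  have h4 : √(κ / y₀) ^ 2 = κ / y₀ := Real.sq_sqrt (div_pos hκ hy₀).le
  rw [hnorm] at h2 h3
  have h5 : y₀ * √(κ / y₀) ^ 2 = κ := by
    rw [h4]
    field_simp
  rw [h2, h3] at h1
  have hpos : 0 < 1 + κ * (‖v‖ ^ 2 * q (√(κ / y₀) • v)) := by
    have := mul_nonneg hκ.le (mul_nonneg (sq_nonneg ‖v‖) (hq0 (√(κ / y₀) • v)))
    positivity
  refine ContinuousLinearMap.ext fun w => ?_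
  change x (√(κ / y₀) * ‖v‖) • leftInvariantForm v w = rescaledFibreForm τ q κ (√(κ / y₀), v) w
  rw [rescaledFibreForm_apply, leftInvariantForm_apply, smul_smul]
  congr 1
  rw [eq_div_iff hpos.ne', ← div_eq_mul_inv, div_mul_eq_mul_div, div_eq_iff (by positivity)]
  field_simp at h1
  rw [mul_add, h5] at h1
  linarith

/-- The rescaled connections converge to the basic instanton, since they form a smooth family which
extends to the scale `0`. The estimate is uniform because the family does not depend on the
fibre. -/
theorem exists_norm_iteratedFDeriv_sub_asdInstanton_lt (h : IsProfile ν₀ t ν)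
    {A : ℝ → OneForm IP (X × ℍ[ℝ]) ℍ[ℝ]}
    (hA : ∀ y₀ : ℝ, 0 < y₀ → S.IsInstantonWithParameter t ν y₀ (A y₀)) {κ : ℝ} (hκ : 0 < κ)
    (hlam : Tendsto (fun y₀ : ℝ => √(κ / y₀)) atTop (𝓝 0)) (k : ℕ) {ε : ℝ} (hε : 0 < ε) :
    ∃ Y : ℝ, 0 < Y ∧ ∀ y₀ : ℝ, Y ≤ y₀ → ∀ p : X, ∀ v ∈ Metric.ball (0 : ℍ[ℝ]) 1,
      ‖iteratedFDeriv ℝ k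
        ((OneForm.pullback IP 𝓘(ℝ, ℍ[ℝ]) (fibreMap p √(κ / y₀)) (A y₀)).coeff
          - (asdInstanton κ).coeff) v‖ < ε := by
  obtain ⟨τ, q, hτ, hq, htτ, hνq, hτ0, hq1⟩ := h.exists_smooth_quotients ℍ[ℝ]
  have hq0 : ∀ v, 0 ≤ q v := by
    intro v
    by_cases hv : v = 0
    · rw [hv, hq1]
      exact zero_le_one
    · have h1 := h.nu_zero_lt (norm_pos_iff.2 hv)
      have h2 := hνq v
      have h3 : 0 < ‖v‖ ^ 2 := by positivity
      exact nonneg_of_mul_nonneg_right (by linarith) h3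
  have hΦ := contDiff_rescaledFibreForm hτ hq hq0 hκ
  have hunif := tendstoUniformlyOn_iteratedFDeriv_slice isOpen_univ hΦ.contDiffOn (c₀ := 0)
    (isCompact_closedBall (0 : ℍ[ℝ]) 1) (fun y _ => mem_univ _) k
  rw [Metric.tendstoUniformlyOn_iff] at hunif
  obtain ⟨Y, hY⟩ := eventually_atTop.1 (hlam.eventually (hunif ε hε))
  refine ⟨max Y 1, by positivity, fun y₀ hy₀ p v hv => ?_⟩
  have hy₀1 : 0 < y₀ := one_pos.trans_le ((le_max_right _ _).trans hy₀)
  have h1 := hY y₀ ((le_max_left _ _).trans hy₀) v (Metric.ball_subset_closedBall hv)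
  have hslice : ∀ c : ℝ, ContDiffAt ℝ k (fun v => rescaledFibreForm τ q κ (c, v)) v := fun c =>
    ((hΦ.comp (contDiff_const.prodMk contDiff_id)).of_le (mod_cast le_top)).contDiffAt
  rw [(hA y₀ hy₀1).coeff_pullback_fibreMap hy₀1 h hτ hq htτ hνq hq0 hκ p,
    ← rescaledFibreForm_zero hτ0 hq1, iteratedFDeriv_sub_apply (hslice _) (hslice _),
    ← dist_eq_norm, dist_comm]
  exact h1

/-! ### Convergence away from the zero section -/

/-- The connections `x η` with `x (c + (ν² - ν₀²) / 3) = t²` depend smoothly on the constant `c`,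
near `c = 0`. -/
theorem tendstoSmoothlyOnCompacts_radialForm (h : IsProfile ν₀ t ν)
    {A : ℝ → OneForm IC (X × ℝ) ℍ[ℝ]} {B : OneForm IC (X × ℝ) ℍ[ℝ]} {x : ℝ → ℝ → ℝ} {x₀ : ℝ → ℝ}
    (hA : ∀ y₀, 0 < y₀ → ∀ q : X × ℝ, 0 < q.2 → A y₀ q = S.radialForm (x y₀) q)
    (hx : ∀ y₀, 0 < y₀ → ∀ r, 0 < r → x y₀ r * (y₀⁻¹ + (ν r ^ 2 - ν₀ ^ 2) / 3) = t r ^ 2)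
    (hB : ∀ q : X × ℝ, 0 < q.2 → B q = S.radialForm x₀ q)
    (hx₀ : ∀ r, 0 < r → x₀ r * (0 + (ν r ^ 2 - ν₀ ^ 2) / 3) = t r ^ 2) :
    OneForm.TendstoSmoothlyOnCompacts IC {q : X × ℝ | 0 < q.2} A B := by
  intro m K hK hKt hKU k
  obtain ⟨τ, q, hτ, hq, htτ, hνq, -, -⟩ := h.exists_smooth_quotients ℝ
  set Φ : ℝ × (EuclideanSpace ℝ (Fin 7) × ℝ) → EuclideanSpace ℝ (Fin 7) × ℝ →L[ℝ] ℍ[ℝ] :=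
    fun z => ((z.2.2 * τ z.2.2) ^ 2 / (z.1 + z.2.2 ^ 2 * q z.2.2)) •
      (OneForm.inChart (𝓡 7) S.η m.1 z.2.1).comp
        (ContinuousLinearMap.fst ℝ (EuclideanSpace ℝ (Fin 7)) ℝ) with hΦ
  set V : Set (EuclideanSpace ℝ (Fin 7) × ℝ) := (extChartAt IC m).target ∩ {y | 0 < y.2} with hV
  have hVo : IsOpen V :=
    (isOpen_extChartAt_target m).inter (isOpen_Ioi.preimage continuous_snd)
  have hKV : ∀ y ∈ K, y ∈ V := by
    intro y hy
    refine ⟨hKt hy, ?_⟩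
    have h1 : 0 < ((extChartAt IC m).symm y).2 := hKU (mem_image_of_mem _ hy)
    rwa [extChartAt_prod_symm_apply] at h1
  set U : Set (ℝ × (EuclideanSpace ℝ (Fin 7) × ℝ)) :=
    (Prod.snd ⁻¹' V) ∩ {z | z.1 + z.2.2 ^ 2 * q z.2.2 ≠ 0} with hU
  have hUo : IsOpen U := by
    refine (hVo.preimage continuous_snd).inter (isOpen_ne_fun ?_ continuous_const)
    have := hq.continuous
    fun_prop
  have hden : ∀ r, 0 < r → r ^ 2 * q r = (ν r ^ 2 - ν₀ ^ 2) / 3 := by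
    intro r hr
    have h1 := hνq r
    rw [Real.norm_of_nonneg hr.le] at h1
    linarith
  have hQ : ∀ r, 0 < r → 0 < (ν r ^ 2 - ν₀ ^ 2) / 3 := fun r hr => by
    have := h.nu_zero_lt hr
    linarith
  have hKU' : ∀ y ∈ K, ((0 : ℝ), y) ∈ U := by
    intro y hy
    refine ⟨hKV y hy, ?_⟩
    have h1 : 0 < y.2 := (hKV y hy).2
    change 0 + y.2 ^ 2 * q y.2 ≠ 0
    rw [hden _ h1, zero_add]
    exact (hQ _ h1).ne'
  have hΦs : ContDiffOn ℝ ∞ Φ U := by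
    have hr : ContDiff ℝ ∞ fun z : ℝ × (EuclideanSpace ℝ (Fin 7) × ℝ) => z.2.2 :=
      contDiff_snd.comp contDiff_snd
    have hη : ContDiffOn ℝ ∞ (fun z : ℝ × (EuclideanSpace ℝ (Fin 7) × ℝ) =>
        OneForm.inChart (𝓡 7) S.η m.1 z.2.1) U :=
      (S.eta_smooth m.1).comp (contDiff_fst.comp contDiff_snd).contDiffOn
        fun z hz => mem_extChartAt_prod_target.1 hz.1.1
    exact (((hr.mul (hτ.comp hr)).pow 2).contDiffOn.div
      (contDiff_fst.add ((hr.pow 2).mul (hq.comp hr))).contDiffOn fun z hz => hz.2).smul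
        (hη.clm_comp contDiffOn_const)
  have hchart : ∀ (c : ℝ) (ξ : ℝ → ℝ) (α : OneForm IC (X × ℝ) ℍ[ℝ]), 0 ≤ c →
      (∀ q : X × ℝ, 0 < q.2 → α q = S.radialForm ξ q) →
      (∀ r, 0 < r → ξ r * (c + (ν r ^ 2 - ν₀ ^ 2) / 3) = t r ^ 2) →
      ∀ y ∈ V, iteratedFDeriv ℝ k (OneForm.inChart IC α m) y =
        iteratedFDeriv ℝ k (fun y => Φ (c, y)) y := by
    intro c ξ α hc hα hξ y hy
    refine (Filter.EventuallyEq.iteratedFDeriv ℝ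
      (eventually_of_mem (hVo.mem_nhds hy) fun z hz => ?_) k).self_of_nhds
    have hz2 : 0 < z.2 := hz.2
    have h1 : 0 < ((extChartAt IC m).symm z).2 := by
      rw [extChartAt_prod_symm_apply]
      exact hz2
    rw [inChart_congr (hα _ h1), S.inChart_radialForm ξ m hz.1]
    simp only [hΦ]
    congr 1
    have h2 := htτ z.2
    rw [Real.norm_of_nonneg hz2.le] at h2
    have h3 := hQ _ hz2
    rw [hden _ hz2, ← h2, eq_div_iff (by linarith)]
    exact hξ _ hz2
  have hlim := tendstoUniformlyOn_iteratedFDeriv_slice hUo hΦs hK hKU' k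
  have hinv : TendstoUniformlyOn (fun y₀ : ℝ => iteratedFDeriv ℝ k fun y => Φ (y₀⁻¹, y))
      (iteratedFDeriv ℝ k fun y => Φ (0, y)) atTop K := fun u hu =>
    tendsto_inv_atTop_zero.eventually (hlim u hu)
  refine (hinv.congr ?_).congr_right fun y hy =>
    (hchart 0 x₀ B le_rfl hB hx₀ y (hKV y hy)).symm
  filter_upwards [eventually_gt_atTop 0] with y₀ hy₀ y hy
  exact (hchart y₀⁻¹ (x y₀) (A y₀) (inv_pos.2 hy₀).le (hA y₀ hy₀) (hx y₀ hy₀) y (hKV y hy)).symm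

/-- The instantons `A_{y₀}` converge to `A_lim` away from the zero section: the constants `1 / y₀`
in their radial functions converge to the constant `0` of `A_lim`. -/
theorem tendstoSmoothlyOnCompacts_limitInstanton (h : IsProfile ν₀ t ν)
    {A : ℝ → OneForm IP (X × ℍ[ℝ]) ℍ[ℝ]}
    (hA : ∀ y₀ : ℝ, 0 < y₀ → S.IsInstantonWithParameter t ν y₀ (A y₀))
    {Alim : OneForm IC (X × ℝ) ℍ[ℝ]} (hAlim : S.IsLimitInstanton t ν Alim) :
    OneForm.TendstoSmoothlyOnCompacts IC {q : X × ℝ | 0 < q.2}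
      (fun y₀ => OneForm.pullback IP IC fromPolar (A y₀)) Alim := by
  intro m
  obtain ⟨x₀, hx₀, hx₀1, hB⟩ := hAlim
  choose! x hx using fun (y₀ : ℝ) (hy₀ : 0 < y₀) => (hA y₀ hy₀).radial
  exact tendstoSmoothlyOnCompacts_radialForm h
    (fun y₀ hy₀ q hq => S.pullback_fromPolar_apply (hx y₀ hy₀).2.1 hq)
    (fun y₀ hy₀ r hr => (hx y₀ hy₀).1.eq_of_tendsto_div_sq h m.1 hy₀ (hx y₀ hy₀).2.2 hr) hB
    (fun r hr => hx₀.eq_of_tendsto_one h m.1 hx₀1 hr) m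

end ThreeSasakian

end SpinSeven

theorem theorem13 {X : Type*} [TopologicalSpace X] [ChartedSpace (EuclideanSpace ℝ (Fin 7)) X]
    [IsManifold (𝓡 7) ∞ X] (S : ThreeSasakian X) (ν₀ : ℝ) (t ν : ℝ → ℝ)
    (hprofile : IsProfile ν₀ t ν)
    (A : ℝ → OneForm IP (X × ℍ[ℝ]) ℍ[ℝ])
    (hA : ∀ y₀ : ℝ, 0 < y₀ → S.IsInstantonWithParameter t ν y₀ (A y₀))
    (Alim : OneForm IC (X × ℝ) ℍ[ℝ]) (hAlim : S.IsLimitInstanton t ν Alim) :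
    (∀ κ : ℝ, 0 < κ →
      Tendsto (fun y₀ : ℝ => √(κ / y₀)) atTop (𝓝 0) ∧
      (∀ y₀ : ℝ, 0 < y₀ → ∀ p : X,
        S.IsScaledExp t ν p √(κ / y₀) (fibreMap p √(κ / y₀))) ∧
      ∀ (k : ℕ) (ε : ℝ), 0 < ε → ∃ Y : ℝ, 0 < Y ∧ ∀ y₀ : ℝ, Y ≤ y₀ → ∀ p : X,
        ∀ v ∈ Metric.ball (0 : ℍ[ℝ]) 1,
          ‖iteratedFDeriv ℝ k
              ((OneForm.pullback IP 𝓘(ℝ, ℍ[ℝ]) (fibreMap p √(κ / y₀)) (A y₀)).coeff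
                - (asdInstanton κ).coeff) v‖ < ε) ∧
    OneForm.TendstoSmoothlyOnCompacts IC {q : X × ℝ | 0 < q.2}
      (fun y₀ => OneForm.pullback IP IC fromPolar (A y₀)) Alim := by
  refine ⟨fun κ hκ => ?_, ThreeSasakian.tendstoSmoothlyOnCompacts_limitInstanton hprofile hA hAlim⟩
  have hlam : Tendsto (fun y₀ : ℝ => √(κ / y₀)) atTop (𝓝 0) := by
    rw [← Real.sqrt_zero]
    exact (Real.continuous_sqrt.tendsto 0).comp (tendsto_const_nhds.div_atTop tendsto_id)
  exact ⟨hlam, fun y₀ _ p => S.isScaledExp_fibreMap t ν p √(κ / y₀), fun k ε hε =>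
    ThreeSasakian.exists_norm_iteratedFDeriv_sub_asdInstanton_lt hprofile hA hκ hlam k hε⟩
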